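/- Let $L\ge 1$, $d\in\mathbb N$, let $\sigma\in C_b^{3\cdot 2^{L-1}}(\mathbb R)$ and $F\in C_b^{3\cdot 2^{L-1}}(\mathbb R^{d})$ be real-valued, where $C_b^N$ is the class of $N$ times continuously differentiable functions that are bounded together with all derivatives up to order $N$. Let $C_W>0$ and let $\mu$ be a probability measure on $\mathbb R$ with mean $0$, variance $1$ and finite third absolute moment. Then there is a constant $C$, depending only on $L,d,\sigma,F,C_W,\mu$, such that the following holds for all positive widths $n_0,n_1,\dots,n_{L}$, with $n_{L+1}=d$. Let $W^{(\ell)},G^{(\ell)}$ ($1\le\ell\le L+1$) be random $n_\ell\times n_{\ell-1}$ matrices, all of whose entries are mutually independent, such that - for $2\le\ell\le L+1$ the entries of $W^{(\ell)}$ are distributed as $\sqrt{C_W/n_{\ell-1}}\,\xi$ with $\xi\sim\mu$; - the entries of $W^{(1)}$ are centred with finite third absolute moments (for instance Gaussian with variance $C_W/n_0$); - for $1\le\ell\le L+1$ the entries of $G^{(\ell)}$ are $\mathcal N(0,C_W/n_{\ell-1})$. For $1\le m\le L+1$ and $x\in\mathbb R^{n_0}$ let $z^{(L+1;m)}(x)\in\mathbb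 R^{d}$ be the output of the fully connected network with $L$ hidden layers, zero biases and activation function $\sigma$ whose weights are $W^{(\ell)}$ in the layers $\ell\le m$ and $G^{(\ell)}$ in the layers $\ell>m$. That is, $z^{(L+1;m)}(x)=z^{(L+1)}$ where $z^{(1)}=\widetilde W^{(1)}x$, $z^{(\ell)}=\widetilde W^{(\ell)}\sigma(z^{(\ell-1)})$ for $2\le\ell\le L+1$ (with $\sigma$ applied componentwise), and $\widetilde W^{(\ell)}=W^{(\ell)}$ for $\ell\le m$, $\widetilde W^{(\ell)}=G^{(\ell)}$ for $\ell>m$. Then for every $x\in\mathbb R^{n_0}$ and every $K\in\{-1,0,\dots,L-2\}$, $$\Bigl|\mathbb E\bigl[F(z^{(L+1;L-K)}(x))\bigr]-\mathbb E\bigl[F(z^{(L+1;L-K-1)}(x))\bigr]\Bigr|\le \frac{C}{\sqrt{n_{L-K-1}}}.$$ -/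

import Mathlib

open MeasureTheory ProbabilityTheory
open scoped Matrix

noncomputable section

/-- The class `C_b^N`: `N` times continuously differentiable real functions which are bounded
together with all their derivatives up to order `N`. -/
def IsCb {E : Type*} [NormedAddCommGroup E] [NormedSpace ℝ E] (N : ℕ) (f : E → ℝ) : Prop :=
  ContDiff ℝ N f ∧ ∀ r ≤ N, ∃ M : ℝ, ∀ x, ‖iteratedFDeriv ℝ r f x‖ ≤ M

/-- Weight matrices of a network with widths `n 0, n 1, n 2, …`. The entry with index `ℓ` is the
weight matrix of layer `ℓ + 1`, which maps `ℝ^{n ℓ}` to `ℝ^{n (ℓ + 1)}`. -/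
abbrev Weights (n : ℕ → ℕ) : Type :=
  (ℓ : ℕ) → Matrix (Fin (n (ℓ + 1))) (Fin (n ℓ)) ℝ

/-- Bias vectors; the entry with index `ℓ` is the bias of layer `ℓ + 1`. -/
abbrev Biases (n : ℕ → ℕ) : Type :=
  (ℓ : ℕ) → Fin (n (ℓ + 1)) → ℝ

/-- The fully connected deep neural network: `dnn σ n W b x ℓ` is `z^{(ℓ + 1)}(x)`, where
`z^{(1)} = W^{(1)} x + b^{(1)}` and `z^{(ℓ)} = W^{(ℓ)} σ(z^{(ℓ - 1)}) + b^{(ℓ)}` for `ℓ ≥ 2`. The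
output of the network with `L` hidden layers is `dnn σ n W b x L`. -/
def dnn (σ : ℝ → ℝ) (n : ℕ → ℕ) (W : Weights n) (b : Biases n) (x : Fin (n 0) → ℝ) :
    (ℓ : ℕ) → Fin (n (ℓ + 1)) → ℝ
  | 0 => W 0 *ᵥ x + b 0
  | ℓ + 1 => W (ℓ + 1) *ᵥ (fun j => σ (dnn σ n W b x ℓ j)) + b (ℓ + 1)

/-- Keep the weights `W^{(1)}, …, W^{(m)}` and replace all later ones by `G^{(m + 1)}, …`. -/
def switchedWeights (n : ℕ → ℕ) (m : ℕ) (W G : Weights n) : Weights n :=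
  fun ℓ => if ℓ + 1 ≤ m then W ℓ else G ℓ

/-- `z^{(L + 1; m)}(x)`: the output of the network with `L` hidden layers and zero biases whose
layers `1, …, m` have the weights `W` and whose layers `m + 1, …, L + 1` have the weights `G`. -/
def switchedOutput (σ : ℝ → ℝ) (L : ℕ) (n : ℕ → ℕ) (m : ℕ) (W G : Weights n)
    (x : Fin (n 0) → ℝ) : Fin (n (L + 1)) → ℝ :=
  dnn σ n (switchedWeights n m W G) 0 x L

/-- The positions `(layer, row, column)` of the weights in the layers `1, …, L + 1`. -/
abbrev WeightIndex (L : ℕ) (n : ℕ → ℕ) : Type :=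
  (ℓ : Fin (L + 1)) × (Fin (n ((ℓ : ℕ) + 1)) × Fin (n (ℓ : ℕ)))

/-- The law `μ` of the normalized weights: a measure on `ℝ` with mean zero, variance one and finite
third absolute moment. -/
structure IsWeightLaw (μ : Measure ℝ) : Prop where
  third_moment : MemLp (fun t : ℝ => t) 3 μ
  mean_zero : ∫ t, t ∂μ = 0
  variance_one : Var[fun t : ℝ => t; μ] = 1

/-- The joint assumptions on the random weights `W` of the network and on the Gaussian
replacement weights `G`. -/
structure IsRandomInit {Ω : Type*} [MeasurableSpace Ω] (P : Measure Ω) (L : ℕ) (n : ℕ → ℕ)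
    (CW : ℝ) (μ : Measure ℝ) (W G : Ω → Weights n) : Prop where
  /-- All entries of all the `W^{(ℓ)}` and all the `G^{(ℓ)}` are mutually independent. -/
  indep : iIndepFun
    (fun (p : WeightIndex L n ⊕ WeightIndex L n) (ω : Ω) =>
      Sum.elim (fun q : WeightIndex L n => W ω q.1 q.2.1 q.2.2)
        (fun q : WeightIndex L n => G ω q.1 q.2.1 q.2.2) p) P
  /-- The weights of the first layer have finite third absolute moments … -/
  first_third_moment : ∀ i j, MemLp (fun ω => W ω 0 i j) 3 P
  /-- … and are centred. -/
  first_mean_zero : ∀ i j, ∫ ω, W ω 0 i j ∂P = 0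
  /-- The weights of the layers `2, …, L + 1` are distributed as `√(C_W / n_{ℓ - 1}) · μ`. -/
  law_W : ∀ ℓ, 1 ≤ ℓ → ℓ ≤ L → ∀ i j,
    HasLaw (fun ω => W ω ℓ i j) (μ.map (fun t => √(CW / (n ℓ : ℝ)) * t)) P
  /-- The entries of `G^{(ℓ)}` are centred Gaussian with variance `C_W / n_{ℓ - 1}`. -/
  law_G : ∀ ℓ ≤ L, ∀ i j,
    HasLaw (fun ω => G ω ℓ i j) (gaussianReal 0 (CW / (n ℓ : ℝ)).toNNReal) P

end

/-! Swapping one layer is a Lindeberg replacement, provided that the later layers, all Gaussian, are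
first integrated out. For a fixed input vector `s`, a Gaussian layer outputs a vector with
independent centred Gaussian entries of common variance `q = (C_W / n) ∑ s_j ^ 2`
(`map_mulVec_pi_gaussian`). Averaging `Φ` over it therefore gives `heat Φ q`, and with `s = σ(y)`
this is a new test function `gaussianBackward σ CW Φ` of the previous preactivation `y`. Iterating
(`exists_backward`) turns the expectation of `F` into that of some `Φ` of the output of the swapped
layer, with the same `Φ` before and after the swap.

The difficulty is to bound the derivatives of `Φ` uniformly in the widths. `BddPartials` demands a
gain of `1 / n` for every distinct direction of differentiation, which is how functions of averages
over `n` coordinates behave. This class is stable under the backward step: the Laplacian of such a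
function is an average of `n` bounded terms (`BddPartials.exists_laplacian`), so the heat equation
`∂_q heat f = (1 / 2) heat (Δ f)` bounds `k` derivatives in `q` by `2 k` derivatives of `f`,
independently of the dimension; and `q` is itself an average in the class. Each backward step halves
the available smoothness, hence the order `3 * 2 ^ (L - 1)`, which leaves the three derivatives that
Lindeberg needs.

For the swapped layer, with `n` inputs and `n'` outputs, there are `n * n'` entries. Replacing one
of them matches the first two moments and costs a third derivative of order `1 / n'` times a third
moment of order `n ^ (-3/2)`. The sum is of order `n ^ (-1/2)`. -/

/-- `BddPartials m I B f`: the function `f` on `ℝ^ι` is `m` times continuously differentiable and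
every iterated partial derivative of order at most `m` is bounded by `B` divided by a factor
`card ι` for each distinct index outside `I` along which `f` is differentiated. -/
def BddPartials {ι : Type*} [Fintype ι] [DecidableEq ι] :
    ℕ → Finset ι → ℝ → ((ι → ℝ) → ℝ) → Prop
  | 0, _, B, f => Continuous f ∧ ∀ y, |f y| ≤ B
  | m + 1, I, B, f => (∀ y, |f y| ≤ B) ∧ ∃ f' : ι → (ι → ℝ) → ℝ,
      (∀ y, HasFDerivAt f
        (∑ j, f' j y • (ContinuousLinearMap.proj j : (ι → ℝ) →L[ℝ] ℝ)) y) ∧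
      ∀ j, BddPartials m (insert j I) B
        (fun y => (if j ∈ I then 1 else (Fintype.card ι : ℝ)) * f' j y)

/-- `BddDerivs s m A g`: on the set `s` of reals the function `g` has `m` continuous derivatives,
all of which, like `g` itself, are bounded by `A`. -/
def BddDerivs (s : Set ℝ) : ℕ → ℝ → (ℝ → ℝ) → Prop
  | 0, A, g => ContinuousOn g s ∧ ∀ x ∈ s, |g x| ≤ A
  | m + 1, A, g => (∀ x ∈ s, |g x| ≤ A) ∧ ∃ g' : ℝ → ℝ,
      (∀ x ∈ s, HasDerivWithinAt g (g' x) s x) ∧ BddDerivs s m A g'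

/-! ### One-variable functions with bounded derivatives -/

namespace BddDerivs

variable {s : Set ℝ} {m : ℕ} {A A' : ℝ} {g : ℝ → ℝ}

lemma abs_le (h : BddDerivs s m A g) : ∀ x ∈ s, |g x| ≤ A := by
  cases m with
  | zero => exact h.2
  | succ m => exact h.1

lemma continuousOn (h : BddDerivs s m A g) : ContinuousOn g s := by
  cases m with
  | zero => exact h.1
  | succ m => obtain ⟨_, g', hg, _⟩ := h; exact fun x hx => (hg x hx).continuousWithinAt

lemma mono (hA : A ≤ A') (h : BddDerivs s m A g) : BddDerivs s m A' g := by
  induction m generalizing g with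
  | zero => exact ⟨h.1, fun x hx => (h.2 x hx).trans hA⟩
  | succ m ih =>
    obtain ⟨h0, g', h1, h2⟩ := h
    exact ⟨fun x hx => (h0 x hx).trans hA, g', h1, ih h2⟩

lemma of_succ (h : BddDerivs s (m + 1) A g) : BddDerivs s m A g := by
  induction m generalizing g with
  | zero => exact ⟨h.continuousOn, h.abs_le⟩
  | succ m ih =>
    obtain ⟨h0, g', h1, h2⟩ := h
    exact ⟨h0, g', h1, ih h2⟩

lemma of_le {k : ℕ} (hk : k ≤ m) (h : BddDerivs s m A g) : BddDerivs s k A g := by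
  induction m, hk using Nat.le_induction with
  | base => exact h
  | succ m _ ih => exact ih h.of_succ

lemma const_mul (c : ℝ) (h : BddDerivs s m A g) :
    BddDerivs s m (|c| * A) (fun x => c * g x) := by
  induction m generalizing g with
  | zero =>
    refine ⟨continuousOn_const.mul h.1, fun x hx => ?_⟩
    rw [abs_mul]; exact mul_le_mul_of_nonneg_left (h.2 x hx) (abs_nonneg c)
  | succ m ih =>
    obtain ⟨h0, g', h1, h2⟩ := h
    refine ⟨fun x hx => ?_, fun x => c * g' x, fun x hx => (h1 x hx).const_mul c, ih h2⟩
    rw [abs_mul]; exact mul_le_mul_of_nonneg_left (h0 x hx) (abs_nonneg c)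

end BddDerivs

/-! ### Calculus in the class of width-weighted partial derivatives -/

namespace BddPartials

variable {ι : Type*} [Fintype ι] [DecidableEq ι] {m : ℕ} {I J : Finset ι} {A B B' : ℝ}
  {f g : (ι → ℝ) → ℝ}

lemma abs_le (h : BddPartials m I B f) (y : ι → ℝ) : |f y| ≤ B := by
  cases m with
  | zero => exact h.2 y
  | succ m => exact h.1 y

lemma nonneg (h : BddPartials m I B f) : 0 ≤ B := (abs_nonneg _).trans (h.abs_le 0)

lemma continuous (h : BddPartials m I B f) : Continuous f := by
  cases m with
  | zero => exact h.1
  | succ m =>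
    obtain ⟨_, f', hf, _⟩ := h
    exact continuous_iff_continuousAt.2 fun y => (hf y).continuousAt

lemma of_succ (h : BddPartials (m + 1) I B f) : BddPartials m I B f := by
  induction m generalizing f I with
  | zero => exact ⟨h.continuous, h.abs_le⟩
  | succ m ih =>
    obtain ⟨h0, f', h1, h2⟩ := h
    exact ⟨h0, f', h1, fun j => ih (h2 j)⟩

lemma of_le {k : ℕ} (hk : k ≤ m) (h : BddPartials m I B f) : BddPartials k I B f := by
  induction m, hk using Nat.le_induction with
  | base => exact h
  | succ m _ ih => exact ih h.of_succ

lemma const_mul (c : ℝ) (h : BddPartials m I B f) :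
    BddPartials m I (|c| * B) (fun y => c * f y) := by
  induction m generalizing f I with
  | zero =>
    refine ⟨continuous_const.mul h.1, fun y => ?_⟩
    rw [abs_mul]; exact mul_le_mul_of_nonneg_left (h.2 y) (abs_nonneg c)
  | succ m ih =>
    obtain ⟨h0, f', h1, h2⟩ := h
    refine ⟨fun y => ?_, fun j y => c * f' j y, fun y => ?_, fun j => ?_⟩
    · rw [abs_mul]; exact mul_le_mul_of_nonneg_left (h0 y) (abs_nonneg c)
    · refine ((h1 y).const_mul c).congr_fderiv ?_
      simp [Finset.smul_sum, smul_smul]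
    · convert ih (h2 j) using 2 with y
      ring

lemma mono (hB : B ≤ B') (h : BddPartials m I B f) : BddPartials m I B' f := by
  induction m generalizing f I with
  | zero => exact ⟨h.1, fun y => (h.2 y).trans hB⟩
  | succ m ih =>
    obtain ⟨h0, f', h1, h2⟩ := h
    exact ⟨fun y => (h0 y).trans hB, f', h1, fun j => ih (h2 j)⟩

/-- A larger set of exempt indices asks for fewer gains `1 / card ι`, and each such factor is at
most one. -/
lemma subset [Nonempty ι] (hIJ : I ⊆ J) (h : BddPartials m I B f) : BddPartials m J B f := by
  induction m generalizing f I J with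
  | zero => exact h
  | succ m ih =>
    obtain ⟨h0, f', h1, h2⟩ := h
    refine ⟨h0, f', h1, fun j => ?_⟩
    have hj := ih (Finset.insert_subset_insert j hIJ) (h2 j)
    by_cases hjI : j ∈ I
    · simpa [hjI, hIJ hjI] using hj
    by_cases hjJ : j ∈ J
    · simp only [hjI, if_false] at hj
      have hn : (1 : ℝ) ≤ Fintype.card ι := by exact_mod_cast Fintype.card_pos
      have := (hj.const_mul (Fintype.card ι : ℝ)⁻¹).mono (B' := B) (by
        rw [abs_of_nonneg (by positivity)]
        exact mul_le_of_le_one_left hj.nonneg (inv_le_one_of_one_le₀ hn))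
      convert this using 2 with y
      simp only [hjJ, if_true]
      field_simp
    · simpa [hjI, hjJ] using hj

lemma add (hf : BddPartials m I A f) (hg : BddPartials m I B g) :
    BddPartials m I (A + B) (fun y => f y + g y) := by
  induction m generalizing f g I with
  | zero =>
    exact ⟨hf.1.add hg.1, fun y => (abs_add_le _ _).trans (add_le_add (hf.2 y) (hg.2 y))⟩
  | succ m ih =>
    obtain ⟨h0, f', h1, h2⟩ := hf
    obtain ⟨k0, g', k1, k2⟩ := hg
    refine ⟨fun y => (abs_add_le _ _).trans (add_le_add (h0 y) (k0 y)),
      fun j y => f' j y + g' j y, fun y => ?_, fun j => ?_⟩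
    · refine ((h1 y).add (k1 y)).congr_fderiv ?_
      simp [add_smul, Finset.sum_add_distrib]
    · convert ih (h2 j) (k2 j) using 2 with y
      ring

lemma mul [Nonempty ι] (hf : BddPartials m I A f) (hg : BddPartials m I B g) :
    BddPartials m I (2 ^ m * (A * B)) (fun y => f y * g y) := by
  induction m generalizing f g I with
  | zero =>
    refine ⟨hf.1.mul hg.1, fun y => ?_⟩
    rw [abs_mul, pow_zero, one_mul]
    exact mul_le_mul (hf.2 y) (hg.2 y) (abs_nonneg _) hf.nonneg
  | succ m ih =>
    have hf0 := hf.of_succ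
    have hg0 := hg.of_succ
    have hA := hf.nonneg
    have hB := hg.nonneg
    obtain ⟨h0, f', h1, h2⟩ := hf
    obtain ⟨k0, g', k1, k2⟩ := hg
    refine ⟨fun y => ?_, fun j y => f y * g' j y + g y * f' j y, fun y => ?_, fun j => ?_⟩
    · rw [abs_mul]
      calc |f y| * |g y| ≤ A * B := mul_le_mul (h0 y) (k0 y) (abs_nonneg _) hA
        _ ≤ 2 ^ (m + 1) * (A * B) :=
          le_mul_of_one_le_left (mul_nonneg hA hB) (one_le_pow₀ (by norm_num))
    · refine ((h1 y).mul (k1 y)).congr_fderiv ?_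
      simp [add_smul, Finset.sum_add_distrib, Finset.smul_sum, smul_smul]
    · have e := (ih (hf0.subset (Finset.subset_insert j I)) (k2 j)).add
        (ih (h2 j) (hg0.subset (Finset.subset_insert j I)))
      convert e using 1
      · ring
      · ext y; ring

/-- Differentiate along a new index `j`. The summands with `i ≠ j` gain `1 / n` by hypothesis; the
summand `i = j` need not, but the prefactor `1 / n` supplies its gain. Each derivative splits off at
most one such diagonal term, whence the factor `m + 1`. -/
lemma average [Nonempty ι] {h : ι → (ι → ℝ) → ℝ} (hB : 0 ≤ B)
    (hh : ∀ i ∉ I, BddPartials m (insert i I) B (h i)) :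
    BddPartials m I ((m + 1) * B)
      (fun y => (Fintype.card ι : ℝ)⁻¹ * ∑ i ∈ Iᶜ, h i y) := by
  have hn : (0 : ℝ) < Fintype.card ι := by exact_mod_cast Fintype.card_pos
  have key : ∀ y, |(Fintype.card ι : ℝ)⁻¹ * ∑ i ∈ Iᶜ, h i y| ≤ B := fun y => by
    rw [abs_mul, abs_of_pos (inv_pos.2 hn), inv_mul_le_iff₀ hn]
    calc |∑ i ∈ Iᶜ, h i y| ≤ ∑ i ∈ Iᶜ, |h i y| := Finset.abs_sum_le_sum_abs _ _
      _ ≤ ∑ i ∈ Iᶜ, B := Finset.sum_le_sum fun i hi => (hh i (by simpa using hi)).abs_le y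
      _ = (Iᶜ.card : ℝ) * B := by simp
      _ ≤ Fintype.card ι * B :=
        mul_le_mul_of_nonneg_right (by exact_mod_cast Finset.card_le_univ _) hB
  induction m generalizing h I with
  | zero =>
    refine ⟨continuous_const.mul (continuous_finsetSum _ fun i hi =>
      (hh i (by simpa using hi)).continuous), fun y => (key y).trans (by simp)⟩
  | succ m ih =>
    -- The sum runs over `Iᶜ`, so the value zero chosen for `i ∈ I` never enters.
    have hh' : ∀ i, ∃ h' : ι → (ι → ℝ) → ℝ, i ∉ I → (∀ y, HasFDerivAt (h i)
        (∑ j, h' j y • (ContinuousLinearMap.proj j : (ι → ℝ) →L[ℝ] ℝ)) y) ∧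
      ∀ j, BddPartials m (insert j (insert i I)) B
        (fun y => (if j ∈ insert i I then 1 else (Fintype.card ι : ℝ)) * h' j y) := fun i => by
      by_cases hi : i ∈ I
      · exact ⟨fun _ _ => 0, fun h => absurd hi h⟩
      · obtain ⟨_, h', h1, h2⟩ := hh i hi
        exact ⟨h', fun _ => ⟨h1, h2⟩⟩
    choose h' h1 using hh'
    refine ⟨fun y => (key y).trans (le_mul_of_one_le_left hB
        (by push_cast; linarith [(Nat.cast_nonneg m : (0 : ℝ) ≤ m)])),
      fun j y => (Fintype.card ι : ℝ)⁻¹ * ∑ i ∈ Iᶜ, h' i j y, fun y => ?_, fun j => ?_⟩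
    · have := (HasFDerivAt.fun_sum (u := Iᶜ) fun i hi => (h1 i (by simpa using hi)).1 y).const_mul
        (Fintype.card ι : ℝ)⁻¹
      refine this.congr_fderiv ?_
      rw [Finset.sum_comm, Finset.smul_sum]
      simp [Finset.sum_smul, mul_smul, Finset.smul_sum]
    -- The off-diagonal summands, to which the induction hypothesis applies.
    · have main : BddPartials m (insert j I) ((m + 1) * B) (fun y => (Fintype.card ι : ℝ)⁻¹ *
          ∑ i ∈ (insert j I)ᶜ, (if j ∈ I then 1 else (Fintype.card ι : ℝ)) * h' i j y) := by
        have hb : ∀ i ∉ insert j I, BddPartials m (insert i (insert j I)) B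
            (fun y => (if j ∈ I then 1 else (Fintype.card ι : ℝ)) * h' i j y) := fun i hi => by
          have hi' : i ∉ I := fun h => hi (Finset.mem_insert_of_mem h)
          have hij : j ≠ i := fun h => hi (h ▸ Finset.mem_insert_self _ _)
          rw [Finset.insert_comm]
          simpa [Finset.mem_insert, hij] using (h1 i hi').2 j
        refine ih hb fun y => ?_
        rw [abs_mul, abs_of_pos (inv_pos.2 hn), inv_mul_le_iff₀ hn]
        calc _ ≤ _ := Finset.abs_sum_le_sum_abs _ _
          _ ≤ ∑ i ∈ (insert j I)ᶜ, B :=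
            Finset.sum_le_sum fun i hi => (hb i (by simpa using hi)).abs_le y
          _ = ((insert j I)ᶜ.card : ℝ) * B := by simp
          _ ≤ Fintype.card ι * B :=
            mul_le_mul_of_nonneg_right (by exact_mod_cast Finset.card_le_univ _) hB
      by_cases hj : j ∈ I
      · simp only [hj, if_true, one_mul, Finset.insert_eq_of_mem] at main ⊢
        exact main.mono (by push_cast; linarith)
      -- The diagonal summand: the weight `n` of the new direction `j` cancels the prefactor `1 /
      -- n`.
      · have hjj : BddPartials m (insert j I) B (h' j j) := by
          simpa using (h1 j hj).2 j
        have := main.add hjj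
        convert this using 1
        · push_cast; ring
        · ext y
          simp only [hj, if_false]
          rw [← Finset.insert_compl_insert hj, Finset.sum_insert (by simp), ← Finset.mul_sum]
          field_simp
          ring

end BddPartials

/-! ### From bounded smooth functions to the two quantitative classes -/

namespace IsCb

variable {E : Type*} [NormedAddCommGroup E] [NormedSpace ℝ E] {m : ℕ} {f : E → ℝ}

lemma mul_fderiv_apply (h : IsCb (m + 1) f) (c : ℝ) (v : E) :
    IsCb m (fun y => c * fderiv ℝ f y v) := by
  have hd : ContDiff ℝ m (fderiv ℝ f) := h.1.fderiv_right (by norm_cast)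
  have hv : ContDiff ℝ m (fun y => fderiv ℝ f y v) := hd.clm_apply contDiff_const
  refine ⟨contDiff_const.mul hv, fun r hr => ?_⟩
  obtain ⟨M, hM⟩ := h.2 (r + 1) (by lia)
  refine ⟨|c| * (‖v‖ * M), fun x => ?_⟩
  have hr' : (r : WithTop ℕ∞) ≤ m := by exact_mod_cast hr
  have e : (fun y => c * fderiv ℝ f y v) = c • (fun y => fderiv ℝ f y v) := rfl
  rw [e, iteratedFDeriv_const_smul_apply (hv.of_le hr').contDiffAt, norm_smul, Real.norm_eq_abs]
  refine mul_le_mul_of_nonneg_left ?_ (abs_nonneg c)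
  refine (norm_iteratedFDeriv_clm_apply_const hd.contDiffAt hr').trans ?_
  rw [norm_iteratedFDeriv_fderiv]
  exact mul_le_mul_of_nonneg_left (hM x) (norm_nonneg v)

lemma exists_abs_le (h : IsCb m f) : ∃ M, ∀ x, |f x| ≤ M := by
  obtain ⟨M, hM⟩ := h.2 0 (Nat.zero_le _)
  exact ⟨M, fun x => by simpa using hM x⟩

lemma differentiable (h : IsCb (m + 1) f) : Differentiable ℝ f :=
  h.1.differentiable (by norm_cast)

lemma exists_bddDerivs {f : ℝ → ℝ} (h : IsCb m f) : ∃ A, BddDerivs Set.univ m A f := by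
  induction m generalizing f with
  | zero =>
    obtain ⟨M, hM⟩ := h.exists_abs_le
    exact ⟨M, h.1.continuous.continuousOn, fun x _ => hM x⟩
  | succ m ih =>
    obtain ⟨M, hM⟩ := h.exists_abs_le
    obtain ⟨A, hA⟩ := ih (h.mul_fderiv_apply 1 1)
    refine ⟨max M A, fun x _ => (hM x).trans (le_max_left _ _), _, fun x _ => ?_,
      hA.mono (le_max_right _ _)⟩
    exact (h.differentiable x).hasDerivAt.hasDerivWithinAt.congr_deriv (by simp)

/-- The weights `card ι` are absorbed into `B`, which thus depends on the dimension. This is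
harmless for `F`, whose dimension `d` is fixed. -/
lemma exists_bddPartials {ι : Type*} [Fintype ι] [DecidableEq ι] {f : (ι → ℝ) → ℝ}
    (h : IsCb m f) (I : Finset ι) : ∃ B, BddPartials m I B f := by
  induction m generalizing f I with
  | zero =>
    obtain ⟨M, hM⟩ := h.exists_abs_le
    exact ⟨M, h.1.continuous, hM⟩
  | succ m ih =>
    obtain ⟨M, hM⟩ := h.exists_abs_le
    choose A hA using fun j => ih (h.mul_fderiv_apply
      (if j ∈ I then 1 else (Fintype.card ι : ℝ)) (Pi.single j 1)) (insert j I)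
    have hA0 := fun j => (hA j).nonneg
    have hM0 : 0 ≤ M := (abs_nonneg _).trans (hM 0)
    refine ⟨M + ∑ j, A j, fun y => (hM y).trans
      (le_add_of_nonneg_right (Finset.sum_nonneg fun j _ => hA0 j)),
      fun j y => fderiv ℝ f y (Pi.single j 1), fun y => ?_, fun j => (hA j).mono ?_⟩
    · refine (h.differentiable y).hasFDerivAt.congr_fderiv (ContinuousLinearMap.ext fun v => ?_)
      conv_lhs => rw [pi_eq_sum_univ' v, map_sum]
      simp [mul_comm]
    · exact (Finset.single_le_sum (fun j _ => hA0 j) (Finset.mem_univ j)).trans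
        (le_add_of_nonneg_left hM0)

end IsCb

/-- A bound for the composition of `g` in `BddDerivs s m A` with `q` in `BddPartials m I B`. -/
def compBound (A B : ℝ) : ℕ → ℝ
  | 0 => A
  | m + 1 => A + 2 ^ m * (compBound A B m * B)

/-! ### Composition, averages of squares and the Laplacian in the weighted class -/

namespace BddPartials

variable {ι : Type*} [Fintype ι] [DecidableEq ι] {m : ℕ} {I : Finset ι} {A B : ℝ}
  {f g : (ι → ℝ) → ℝ}

lemma zero (hB : 0 ≤ B) : BddPartials m I B (fun _ => 0) := by
  induction m generalizing I with
  | zero => exact ⟨continuous_const, fun y => by simpa using hB⟩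
  | succ m ih =>
    exact ⟨fun y => by simpa using hB, fun _ _ => 0,
      fun y => (hasFDerivAt_const 0 y).congr_fderiv (by simp), fun j => by simpa using ih⟩

lemma comp_apply {g : ℝ → ℝ} (h : BddDerivs Set.univ m A g) {i : ι} (hi : i ∈ I) :
    BddPartials m I A (fun y => g (y i)) := by
  have hA : 0 ≤ A := (abs_nonneg _).trans (h.abs_le 0 trivial)
  induction m generalizing g I with
  | zero =>
    exact ⟨(continuousOn_univ.1 h.1).comp (continuous_apply i), fun y => h.2 _ trivial⟩
  | succ m ih =>
    obtain ⟨h0, g', h1, h2⟩ := h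
    refine ⟨fun y => h0 _ trivial, fun j y => if j = i then g' (y i) else 0, fun y => ?_,
      fun j => ?_⟩
    · have := (hasDerivWithinAt_univ.1 (h1 (y i) trivial)).comp_hasFDerivAt y
        (hasFDerivAt_apply (𝕜 := ℝ) i y)
      refine this.congr_fderiv ?_
      simp [ite_smul]
    · by_cases hj : j = i
      · subst hj
        simpa [hi] using ih h2 hi
      · simpa [hj] using zero (m := m) (I := insert j I) hA

/-- In the chain rule `g'(q) * ∂_j q` the weight of direction `j` goes to `∂_j q`, and `g' ∘ q` is
handled by induction. Derivatives within `s` suffice because `q` never leaves `s`; the intended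
outer function `heat` is only controlled on `[0, ∞)`. -/
lemma comp [Nonempty ι] {g : ℝ → ℝ} {s : Set ℝ} {q : (ι → ℝ) → ℝ} (hs : ∀ y, q y ∈ s)
    (hg : BddDerivs s m A g) (hq : BddPartials m I B q) :
    BddPartials m I (compBound A B m) (fun y => g (q y)) := by
  have hA : 0 ≤ A := (abs_nonneg _).trans (hg.abs_le (q 0) (hs 0))
  have hB : 0 ≤ B := hq.nonneg
  have hK : ∀ k, 0 ≤ compBound A B k := fun k => by
    induction k with
    | zero => exact hA
    | succ k ih => simp only [compBound]; positivity
  induction m generalizing g I with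
  | zero =>
    exact ⟨hg.1.comp_continuous hq.1 hs, fun y => hg.2 _ (hs y)⟩
  | succ m ih =>
    have hq' := hq.of_succ
    obtain ⟨h0, g', h1, h2⟩ := hg
    obtain ⟨_, q', k1, k2⟩ := hq
    refine ⟨fun y => (h0 _ (hs y)).trans (le_add_of_nonneg_right ?_),
      fun j y => g' (q y) * q' j y, fun y => ?_, fun j => ?_⟩
    · have := hK m; positivity
    · refine ((h1 _ (hs y)).comp_hasFDerivAt y (k1 y)
        (Filter.Eventually.of_forall hs)).congr_fderiv ?_
      simp [Finset.smul_sum, smul_smul]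
    · have := (ih h2 (hq'.subset (Finset.subset_insert j I))).mul (k2 j)
      refine BddPartials.mono (B := 2 ^ m * (compBound A B m * B)) (le_add_of_nonneg_left hA) ?_
      convert this using 2 with y
      ring

/-- The normalized squared length of `σ(y)`, as a function of `y`. -/
lemma sq_average [Nonempty ι] {σ : ℝ → ℝ} (h : BddDerivs Set.univ m A σ) (c : ℝ) :
    BddPartials m (∅ : Finset ι) ((m + 1) * (|c| * (2 ^ m * (A * A))))
      (fun y => (Fintype.card ι : ℝ)⁻¹ * ∑ i, c * (σ (y i) * σ (y i))) := by
  have hA : 0 ≤ A := (abs_nonneg _).trans (h.abs_le 0 trivial)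
  have := average (m := m) (I := (∅ : Finset ι)) (B := |c| * (2 ^ m * (A * A)))
    (h := fun i y => c * (σ (y i) * σ (y i))) (by positivity)
    fun i _ => ((comp_apply h (Finset.mem_insert_self i ∅)).mul
      (comp_apply h (Finset.mem_insert_self i ∅))).const_mul c
  simpa using this

/-- The second derivative along `i` twice earns one gain `1 / n`, not two. That is exactly enough:
the Laplacian becomes an average of the functions `n * ∂_i ∂_i f`, whose only exempt index is `i`,
so `average` applies. -/
lemma exists_laplacian [Nonempty ι] (h : BddPartials (m + 2) ∅ B f) :
    ∃ f' f'' : ι → (ι → ℝ) → ℝ,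
      (∀ y, HasFDerivAt f
        (∑ j, f' j y • (ContinuousLinearMap.proj j : (ι → ℝ) →L[ℝ] ℝ)) y) ∧
      (∀ i y t, HasDerivAt (fun t => f' i (Function.update y i t))
        (f'' i (Function.update y i t)) t) ∧
      (∀ i, Continuous (f' i)) ∧ (∀ i, Continuous (f'' i)) ∧
      (∀ i y, |f' i y| ≤ B) ∧ (∀ i y, |f'' i y| ≤ B) ∧
      BddPartials m ∅ ((m + 1) * B) (fun y => ∑ i, f'' i y) := by
  have hB := h.nonneg
  obtain ⟨_, f', h1, h2⟩ := h
  have hn : (1 : ℝ) ≤ Fintype.card ι := by exact_mod_cast Fintype.card_pos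
  have hn0 : (0 : ℝ) < Fintype.card ι := by linarith
  have hc : ∀ i y, f' i y = (Fintype.card ι : ℝ)⁻¹ * (Fintype.card ι * f' i y) := fun i y => by
    field_simp
  have hcb : ∀ x : ℝ, |x| ≤ B → |(Fintype.card ι : ℝ)⁻¹ * x| ≤ B := fun x hx => by
    rw [abs_mul, abs_of_pos (inv_pos.2 hn0)]
    exact (mul_le_of_le_one_left (abs_nonneg x) (inv_le_one_of_one_le₀ hn)).trans hx
  simp only [Finset.notMem_empty, if_false] at h2
  have h2' := h2
  choose _ g h3 h4 using h2
  have h5 : ∀ i, BddPartials m (insert i ∅) B (g i i) := fun i => by simpa using h4 i i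
  refine ⟨f', fun i y => (Fintype.card ι : ℝ)⁻¹ * g i i y, h1, fun i y t => ?_, fun i => ?_,
    fun i => ?_, fun i y => ?_, fun i y => hcb _ ((h5 i).abs_le y), ?_⟩
  · have hu : HasDerivAt (fun t => Function.update y i t) (Pi.single i 1) t :=
      hasDerivAt_update y i t
    have := ((h3 i (Function.update y i t)).comp_hasDerivAt t hu).const_mul
      (Fintype.card ι : ℝ)⁻¹
    refine (this.congr_deriv ?_).congr_of_eventuallyEq (Filter.Eventually.of_forall fun s => hc i _)
    simp [Pi.single_apply]
  · rw [show f' i = fun y => _ from funext (hc i)]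
    exact continuous_const.mul (h2' i).continuous
  · exact continuous_const.mul (h5 i).continuous
  · rw [hc]; exact hcb _ ((h2' i).abs_le y)
  · have := average (m := m) (I := (∅ : Finset ι)) (h := fun i => g i i) hB (fun i _ => h5 i)
    simpa [Finset.mul_sum] using this

end BddPartials

/-! ### Resampling coordinates of product measures -/

section Resampling

variable {ι : Type*} [Fintype ι]

/-- Resampling the coordinates in `S` of a product measure. -/
lemma map_prod_pi_ite [DecidableEq ι] (μ ν : ι → Measure ℝ) [∀ i, IsProbabilityMeasure (μ i)]
    [∀ i, IsProbabilityMeasure (ν i)] (S : Set ι) [DecidablePred (· ∈ S)] :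
    ((Measure.pi μ).prod (Measure.pi ν)).map (fun p i => if i ∈ S then p.2 i else p.1 i) =
      Measure.pi (fun i => if i ∈ S then ν i else μ i) := by
  have : ∀ i, IsProbabilityMeasure (if i ∈ S then ν i else μ i) := fun i => by
    split_ifs <;> infer_instance
  have hm : Measurable fun (p : (ι → ℝ) × (ι → ℝ)) (i : ι) => if i ∈ S then p.2 i else p.1 i := by
    refine measurable_pi_lambda _ fun i => ?_
    split_ifs <;> fun_prop
  refine (Measure.pi_eq fun s hs => ?_).symm
  rw [Measure.map_apply hm (MeasurableSet.univ_pi hs)]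
  have e : (fun (p : (ι → ℝ) × (ι → ℝ)) (i : ι) => if i ∈ S then p.2 i else p.1 i) ⁻¹'
      Set.univ.pi s = (Set.univ.pi fun i => if i ∈ S then Set.univ else s i) ×ˢ
        (Set.univ.pi fun i => if i ∈ S then s i else Set.univ) := by
    ext p
    simp only [Set.mem_preimage, Set.mem_univ_pi, Set.mem_prod, ← forall_and]
    refine forall_congr' fun i => ?_
    by_cases hi : i ∈ S <;> simp [hi]
  rw [e, Measure.prod_prod, Measure.pi_pi, Measure.pi_pi, ← Finset.prod_mul_distrib]
  refine Finset.prod_congr rfl fun i _ => ?_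
  by_cases hi : i ∈ S <;> simp [hi]

omit [Fintype ι] in
lemma measurable_update_prod [DecidableEq ι] (i : ι) :
    Measurable fun (p : (ι → ℝ) × ℝ) => Function.update p.1 i p.2 := by
  refine measurable_pi_lambda _ fun j => ?_
  by_cases h : j = i
  · subst h; simpa using measurable_snd
  · simp only [Function.update_of_ne h]; fun_prop

/-- Resampling one coordinate of a product measure. -/
lemma map_prod_pi_update [DecidableEq ι] (μ : ι → Measure ℝ) [∀ i, IsProbabilityMeasure (μ i)]
    (i : ι) (ν : Measure ℝ) [IsProbabilityMeasure ν] :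
    ((Measure.pi μ).prod ν).map (fun p => Function.update p.1 i p.2) =
      Measure.pi (Function.update μ i ν) := by
  have : ∀ j, IsProbabilityMeasure (Function.update μ i ν j) := fun j => by
    by_cases h : j = i
    · subst h; simpa
    · simpa [h] using inferInstanceAs (IsProbabilityMeasure (μ j))
  have hm := measurable_update_prod (ι := ι) i
  refine (Measure.pi_eq fun s hs => ?_).symm
  rw [Measure.map_apply hm (MeasurableSet.univ_pi hs)]
  have e : (fun (p : (ι → ℝ) × ℝ) => Function.update p.1 i p.2) ⁻¹'
      Set.univ.pi s = (Set.univ.pi (Function.update s i Set.univ)) ×ˢ (s i) := by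
    ext p
    simp only [Set.mem_preimage, Set.mem_univ_pi, Set.mem_prod]
    constructor
    · refine fun h => ⟨fun j => ?_, by simpa using h i⟩
      by_cases hj : j = i
      · subst hj; simp
      · simpa [hj] using h j
    · rintro ⟨h, h'⟩ j
      by_cases hj : j = i
      · subst hj; simpa
      · simpa [hj] using h j
  rw [e, Measure.prod_prod, Measure.pi_pi, ← Finset.prod_erase_mul _ _ (Finset.mem_univ i),
    ← Finset.prod_erase_mul (a := i) _ _ (Finset.mem_univ i)]
  simp only [Function.update_self, measure_univ, mul_one]
  congr 1
  refine Finset.prod_congr rfl fun j hj => ?_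
  have := Finset.ne_of_mem_erase hj
  simp [this]

lemma integral_pi_update [DecidableEq ι] (μ : ι → Measure ℝ) [∀ i, IsProbabilityMeasure (μ i)]
    (i : ι) (ν : Measure ℝ) [IsProbabilityMeasure ν] {f : (ι → ℝ) → ℝ} (hf : Measurable f)
    (hfi : Integrable f (Measure.pi (Function.update μ i ν))) :
    ∫ z, f z ∂(Measure.pi (Function.update μ i ν)) =
      ∫ z, ∫ t, f (Function.update z i t) ∂ν ∂(Measure.pi μ) := by
  rw [← map_prod_pi_update] at hfi ⊢
  have hm := measurable_update_prod (ι := ι) i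
  rw [integral_map hm.aemeasurable hf.aestronglyMeasurable]
  exact integral_prod _
    ((integrable_map_measure hf.aestronglyMeasurable hm.aemeasurable).1 hfi)

end Resampling

/-! ### Gaussian integration by parts -/

section GaussianIntegrationByParts

lemma hasDerivAt_gaussianPDFReal (t : ℝ) :
    HasDerivAt (gaussianPDFReal 0 1) (-t * gaussianPDFReal 0 1 t) t := by
  have h : HasDerivAt (fun t : ℝ => (√(2 * Real.pi * (1 : NNReal)))⁻¹ *
      Real.exp (-(t - 0) ^ 2 / (2 * (1 : NNReal)))) _ t :=
    (((((hasDerivAt_id t).sub_const 0).pow 2).neg.div_const (2 * ((1 : NNReal) : ℝ))).exp).const_mul _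
  rw [gaussianPDFReal_def]
  refine h.congr_deriv ?_
  simp
  ring

lemma integral_mul_gaussianReal_eq {φ φ' : ℝ → ℝ} {B : ℝ} (h : ∀ t, HasDerivAt φ (φ' t) t)
    (hφ' : Continuous φ') (hb : ∀ t, |φ t| ≤ B) (hb' : ∀ t, |φ' t| ≤ B) :
    ∫ t, t * φ t ∂(gaussianReal 0 1) = ∫ t, φ' t ∂(gaussianReal 0 1) := by
  have hφ : Continuous φ := continuous_iff_continuousAt.2 fun t => (h t).continuousAt
  have hp := integrable_gaussianPDFReal 0 1
  have hid : Integrable (fun t : ℝ => t) (gaussianReal 0 1) :=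
    (memLp_id_gaussianReal 1).integrable (by simp)
  have hid' : Integrable (fun t : ℝ => gaussianPDFReal 0 1 t * t) := by
    rw [gaussianReal_of_var_ne_zero _ one_ne_zero, integrable_withDensity_iff_integrable_smul'
      (measurable_gaussianPDF 0 1) (Filter.Eventually.of_forall fun _ => gaussianPDF_lt_top)] at hid
    simpa [toReal_gaussianPDF] using hid
  rw [integral_gaussianReal_eq_integral_smul one_ne_zero,
    integral_gaussianReal_eq_integral_smul one_ne_zero]
  have key := integral_mul_deriv_eq_deriv_mul_of_integrable (u := φ) (u' := φ')
    (v := gaussianPDFReal 0 1) (v' := fun t => -t * gaussianPDFReal 0 1 t)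
    (fun t _ => h t) (fun t _ => hasDerivAt_gaussianPDFReal t)
    (by
      refine (hid'.neg.bdd_mul (c := B) hφ.aestronglyMeasurable
        (Filter.Eventually.of_forall hb)).congr (Filter.Eventually.of_forall fun t => ?_)
      simp; ring_nf; simp)
    (hp.bdd_mul (c := B) hφ'.aestronglyMeasurable (Filter.Eventually.of_forall hb'))
    (hp.bdd_mul (c := B) hφ.aestronglyMeasurable (Filter.Eventually.of_forall hb))
  simp only [smul_eq_mul]
  calc ∫ t, gaussianPDFReal 0 1 t * (t * φ t)
      = -∫ t, φ t * (-t * gaussianPDFReal 0 1 t) := by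
        rw [← integral_neg]; congr 1; ext t; ring
    _ = ∫ t, φ' t * gaussianPDFReal 0 1 t := by rw [key, neg_neg]
    _ = _ := by simp_rw [mul_comm]

variable {ι : Type*} [Fintype ι]

/-- The standard Gaussian measure on `ℝ^ι`. -/
noncomputable def stdGaussianPi (ι : Type*) [Fintype ι] : Measure (ι → ℝ) :=
  Measure.pi fun _ => gaussianReal 0 1

instance : IsProbabilityMeasure (stdGaussianPi ι) := by
  unfold stdGaussianPi; infer_instance

lemma integrable_apply_stdGaussianPi (i : ι) :
    Integrable (fun z : ι → ℝ => z i) (stdGaussianPi ι) := by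
  have hid : Integrable (fun t : ℝ => t) (gaussianReal 0 1) :=
    (memLp_id_gaussianReal 1).integrable (by simp)
  exact (measurePreserving_eval (fun _ : ι => gaussianReal 0 1) i).integrable_comp_of_integrable hid

lemma integral_apply_mul_stdGaussianPi [DecidableEq ι] {h h' : (ι → ℝ) → ℝ} {B : ℝ} (i : ι)
    (hh : ∀ y t, HasDerivAt (fun t => h (Function.update y i t)) (h' (Function.update y i t)) t)
    (hc : Continuous h) (hc' : Continuous h') (hb : ∀ y, |h y| ≤ B) (hb' : ∀ y, |h' y| ≤ B) :
    ∫ z, z i * h z ∂(stdGaussianPi ι) = ∫ z, h' z ∂(stdGaussianPi ι) := by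
  have e : Function.update (fun _ : ι => gaussianReal 0 1) i (gaussianReal 0 1) =
    fun _ => gaussianReal 0 1 := Function.update_eq_self i _
  have hu : ∀ y : ι → ℝ, Continuous fun t => Function.update y i t :=
    fun y => continuous_const.update i continuous_id
  unfold stdGaussianPi
  have i1 : Integrable (fun z : ι → ℝ => z i * h z) (Measure.pi fun _ => gaussianReal 0 1) :=
    (integrable_apply_stdGaussianPi i).mul_bdd (c := B) hc.aestronglyMeasurable
      (Filter.Eventually.of_forall hb)
  have i2 : Integrable h' (Measure.pi fun _ => gaussianReal 0 1) :=
    .of_bound hc'.aestronglyMeasurable B (Filter.Eventually.of_forall hb')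
  rw [← e] at i1 i2
  rw [← e, integral_pi_update _ i _ (by fun_prop) i1, integral_pi_update _ i _ (by fun_prop) i2]
  refine integral_congr_ae (Filter.Eventually.of_forall fun y => ?_)
  simp only [Function.update_self]
  exact integral_mul_gaussianReal_eq (hh y) (hc'.comp (hu y)) (fun t => hb _) (fun t => hb' _)

end GaussianIntegrationByParts

/-! ### The heat semigroup in the variance parameter -/

section Heat

variable {ι : Type*} [Fintype ι]

/-- The Gaussian average `q ↦ 𝔼 f(√q Z)` with a standard Gaussian vector `Z`. -/
noncomputable def heat (f : (ι → ℝ) → ℝ) (q : ℝ) : ℝ := ∫ z, f (√q • z) ∂(stdGaussianPi ι)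

lemma continuous_heat {f : (ι → ℝ) → ℝ} {B : ℝ} (hf : Continuous f) (hb : ∀ y, |f y| ≤ B) :
    Continuous (heat f) := by
  refine continuous_of_dominated (bound := fun _ => B) (fun q => ?_)
    (fun q => Filter.Eventually.of_forall fun z => hb _) (integrable_const B)
    (Filter.Eventually.of_forall fun z => ?_)
  · exact (hf.comp (by fun_prop)).aestronglyMeasurable
  · exact hf.comp (by fun_prop)

lemma abs_heat_le {f : (ι → ℝ) → ℝ} {B : ℝ} (hb : ∀ y, |f y| ≤ B) (q : ℝ) :
    |heat f q| ≤ B := by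
  have := norm_integral_le_of_norm_le_const (μ := stdGaussianPi ι) (f := fun z => f (√q • z))
    (Filter.Eventually.of_forall fun z => hb _)
  simpa [heat] using this

/-- Differentiating `√q` produces `∑ Z_i ∂_i f(√q Z) / (2 √q)`; integration by parts in each `Z_i`
trades `Z_i` for `√q ∂_i`, and the singular factor cancels. -/
lemma hasDerivAt_heat [DecidableEq ι] {f : (ι → ℝ) → ℝ} {f' f'' : ι → (ι → ℝ) → ℝ} {A B : ℝ}
    (h1 : ∀ y, HasFDerivAt f
      (∑ j, f' j y • (ContinuousLinearMap.proj j : (ι → ℝ) →L[ℝ] ℝ)) y)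
    (h2 : ∀ i y t, HasDerivAt (fun t => f' i (Function.update y i t))
      (f'' i (Function.update y i t)) t)
    (hc' : ∀ i, Continuous (f' i)) (hc'' : ∀ i, Continuous (f'' i)) (hb : ∀ y, |f y| ≤ A)
    (hb' : ∀ i y, |f' i y| ≤ B) (hb'' : ∀ i y, |f'' i y| ≤ B) {q : ℝ} (hq : 0 < q) :
    HasDerivAt (heat f) (1 / 2 * heat (fun y => ∑ i, f'' i y) q) q := by
  have hf : Continuous f := continuous_iff_continuousAt.2 fun y => (h1 y).continuousAt
  have hsc : ∀ p : ℝ, Continuous fun z : ι → ℝ => √p • z := fun p => by fun_prop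
  have hB : ∀ i, 0 ≤ B := fun i => (abs_nonneg _).trans (hb' i 0)
  -- Staying above `q / 2` keeps `1 / √p` bounded, which gives an integrable dominating function.
  have main := hasDerivAt_integral_of_dominated_loc_of_deriv_le (μ := stdGaussianPi ι)
    (F := fun p z => f (√p • z)) (x₀ := q) (s := Set.Ioi (q / 2))
    (F' := fun p z => ∑ i, f' i (√p • z) * (1 / (2 * √p) * z i))
    (bound := fun z => ∑ i, B * (1 / (2 * √(q / 2)) * |z i|))
    (Ioi_mem_nhds (by linarith))
    (Filter.Eventually.of_forall fun p => (hf.comp (hsc p)).aestronglyMeasurable)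
    (.of_bound (hf.comp (hsc q)).aestronglyMeasurable A (Filter.Eventually.of_forall fun z => hb _))
    (Continuous.aestronglyMeasurable (continuous_finsetSum _ fun i _ =>
      ((hc' i).comp (hsc q)).mul (by fun_prop)))
    (Filter.Eventually.of_forall fun z p hp => ?_)
    (integrable_finsetSum _ fun i _ =>
      (((integrable_apply_stdGaussianPi i).abs).const_mul _).const_mul _)
    (Filter.Eventually.of_forall fun z p hp => ?_)
  · refine main.2.congr_deriv ?_
    have hint : ∀ i, Integrable (fun z => f' i (√q • z) * (1 / (2 * √q) * z i))
        (stdGaussianPi ι) := fun i =>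
      ((integrable_apply_stdGaussianPi i).const_mul _).bdd_mul (c := B)
        ((hc' i).comp (hsc q)).aestronglyMeasurable (Filter.Eventually.of_forall fun z => hb' i _)
    have hint' : ∀ i, Integrable (fun z => f'' i (√q • z)) (stdGaussianPi ι) := fun i =>
      .of_bound ((hc'' i).comp (hsc q)).aestronglyMeasurable B
        (Filter.Eventually.of_forall fun z => hb'' i _)
    have hs : 0 < √q := Real.sqrt_pos.2 hq
    unfold heat
    rw [integral_finsetSum _ fun i _ => hint i, integral_finsetSum _ fun i _ => hint' i,
      Finset.mul_sum]
    refine Finset.sum_congr rfl fun i _ => ?_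
    have hu : ∀ (y : ι → ℝ) t, √q • Function.update y i t =
        Function.update (√q • y) i (√q * t) := fun y t => by
      ext j
      by_cases hj : j = i
      · subst hj; simp
      · simp [hj]
    have ibp := integral_apply_mul_stdGaussianPi (i := i) (B := max B (√q * B))
      (h := fun z => f' i (√q • z)) (h' := fun z => √q * f'' i (√q • z))
      (fun y t => by
        simp only [hu]
        have := (h2 i (√q • y) (√q * t)).comp t ((hasDerivAt_id t).const_mul √q)
        refine this.congr_deriv ?_
        ring)
      ((hc' i).comp (hsc q)) (continuous_const.mul ((hc'' i).comp (hsc q)))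
      (fun y => (hb' i _).trans (le_max_left _ _))
      (fun y => by
        rw [abs_mul, abs_of_pos hs]
        exact (mul_le_mul_of_nonneg_left (hb'' i _) hs.le).trans (le_max_right _ _))
    rw [integral_const_mul] at ibp
    calc ∫ z, f' i (√q • z) * (1 / (2 * √q) * z i) ∂(stdGaussianPi ι)
        = 1 / (2 * √q) * ∫ z, z i * f' i (√q • z) ∂(stdGaussianPi ι) := by
          rw [← integral_const_mul]; congr 1; ext z; ring
      _ = _ := by rw [ibp]; field_simp
  · have hp0 : q / 2 ≤ p := le_of_lt hp
    refine (norm_sum_le _ _).trans (Finset.sum_le_sum fun i _ => ?_)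
    rw [Real.norm_eq_abs, abs_mul, abs_mul, abs_of_nonneg (a := 1 / (2 * √p)) (by positivity)]
    have : 0 < √(q / 2) := Real.sqrt_pos.2 (by linarith)
    refine mul_le_mul (hb' i _) ?_ (by positivity) (hB i)
    gcongr
  · have hp0 : 0 < p := lt_trans (by linarith) hp
    have hs := (Real.hasDerivAt_sqrt hp0.ne').smul_const z
    have := (h1 (√p • z)).comp_hasDerivAt p hs
    refine this.congr_deriv ?_
    simp only [one_div, mul_inv_rev, map_smul, sum_apply, smul_apply,
      ContinuousLinearMap.proj_apply, smul_eq_mul, Finset.mul_sum]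
    exact Finset.sum_congr rfl fun i _ => by ring

/-- Each derivative in `q` replaces `f` by half its Laplacian, which stays in the class at the cost
of two orders. The bound is chosen before `ι`: it does not see the dimension. -/
lemma BddPartials.exists_bddDerivs_heat (k : ℕ) (B : ℝ) : ∃ K : ℝ,
    ∀ (ι : Type) [Fintype ι] [DecidableEq ι] [Nonempty ι] (f : (ι → ℝ) → ℝ),
      BddPartials (2 * k) ∅ B f → BddDerivs (Set.Ici 0) k K (heat f) := by
  induction k generalizing B with
  | zero =>
    exact ⟨B, fun ι _ _ _ f hf =>
      ⟨(continuous_heat hf.continuous hf.abs_le).continuousOn, fun q _ => abs_heat_le hf.abs_le q⟩⟩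
  | succ k ih =>
    obtain ⟨K, hK⟩ := ih (((2 * k : ℕ) + 1) * B)
    refine ⟨max B (|1 / 2| * K), fun ι _ _ _ f hf => ?_⟩
    obtain ⟨f', f'', h1, h2, hc', hc'', hb', hb'', hL⟩ :=
      BddPartials.exists_laplacian (m := 2 * k) hf
    have hd := fun (q : ℝ) (hq : 0 < q) => hasDerivAt_heat h1 h2 hc' hc'' hf.abs_le hb' hb'' hq
    have hcL := continuous_heat hL.continuous hL.abs_le
    refine ⟨fun q _ => (abs_heat_le hf.abs_le q).trans (le_max_left _ _), _, fun q hq => ?_,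
      (((hK ι _ hL).const_mul (1 / 2)).mono (le_max_right _ _))⟩
    rcases (show (0 : ℝ) ≤ q from hq).eq_or_lt with rfl | hq
    -- At `q = 0` the square root is singular, so the one-sided derivative is obtained as the limit
    -- of the derivatives at positive `q`.
    · refine hasDerivWithinAt_Ici_of_tendsto_deriv (s := Set.Ioi 0)
        (fun q hq => (hd q hq).differentiableAt.differentiableWithinAt)
        (continuous_heat hf.continuous hf.abs_le).continuousWithinAt self_mem_nhdsWithin ?_
      refine Filter.Tendsto.congr' (f₁ := fun q => 1 / 2 * heat (fun y => ∑ i, f'' i y) q) ?_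
        (((continuous_const.mul hcL).tendsto 0).mono_left nhdsWithin_le_nhds)
      filter_upwards [self_mem_nhdsWithin] with q hq
      exact (hd q hq).deriv.symm
    · exact (hd q hq).hasDerivWithinAt

end Heat

/-! ### Integrating out a Gaussian layer -/

section GaussianLayer

lemma charFunDual_real_eq_charFun (μ : Measure ℝ) (Λ : StrongDual ℝ ℝ) :
    charFunDual μ Λ = charFun μ (Λ 1) := by
  rw [charFunDual_apply, charFun_apply_real]
  congr 1
  ext x
  have : Λ x = x * Λ 1 := by
    conv_lhs => rw [← mul_one x, ← smul_eq_mul, map_smul, smul_eq_mul]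
  rw [this]
  push_cast
  ring_nf

lemma charFunDual_stdGaussianPi {κ : Type*} [Fintype κ] [DecidableEq κ]
    (Λ : StrongDual ℝ (κ → ℝ)) :
    charFunDual (stdGaussianPi κ) Λ = ∏ i, Complex.exp (-(Λ (Pi.single i 1) : ℂ) ^ 2 / 2) := by
  rw [stdGaussianPi, charFunDual_pi]
  refine Finset.prod_congr rfl fun i _ => ?_
  rw [charFunDual_real_eq_charFun, charFun_gaussianReal]
  simp [neg_div]

variable {I κ β : Type*} [Fintype I] [Fintype κ] [Fintype β]

/-- A matrix with independent centred Gaussian entries maps a vector `s` to a centred Gaussian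
vector with independent entries. -/
lemma map_mulVec_pi_gaussian (lam : I → Measure ℝ)
    [∀ p, IsProbabilityMeasure (lam p)] {e : κ × β → I} (he : Function.Injective e) {v : ℝ}
    (hv : 0 ≤ v) (hlam : ∀ p, lam (e p) = gaussianReal 0 v.toNNReal) (s : β → ℝ) :
    (Measure.pi lam).map (fun t i => ∑ j, t (e (i, j)) * s j) =
      (stdGaussianPi κ).map (fun z => √(v * ∑ j, s j ^ 2) • z) := by
  classical
  let T : (I → ℝ) →L[ℝ] (κ → ℝ) :=
    ContinuousLinearMap.pi fun i => ∑ j, s j • ContinuousLinearMap.proj (e (i, j))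
  let R : (κ → ℝ) →L[ℝ] (κ → ℝ) := √(v * ∑ j, s j ^ 2) • ContinuousLinearMap.id ℝ (κ → ℝ)
  have hT : (fun (t : I → ℝ) i => ∑ j, t (e (i, j)) * s j) = T := by
    ext t i
    simp [T, mul_comm]
  have hR : (fun z : κ → ℝ => √(v * ∑ j, s j ^ 2) • z) = R := by
    ext z i
    simp [R]
  have : IsProbabilityMeasure ((Measure.pi lam).map T) :=
    Measure.isProbabilityMeasure_map T.continuous.aemeasurable
  have : IsProbabilityMeasure ((stdGaussianPi κ).map R) :=
    Measure.isProbabilityMeasure_map R.continuous.aemeasurable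
  rw [hT, hR]
  refine Measure.ext_of_charFunDual (funext fun Λ => ?_)
  rw [charFunDual_map, charFunDual_map, charFunDual_pi, charFunDual_stdGaussianPi]
  have hsingle : ∀ i j, T (Pi.single (e (i, j)) 1) = s j • Pi.single i (1 : ℝ) := fun i j => by
    ext i'
    by_cases h : i' = i
    · subst h
      simp [T, Pi.single_apply, he.eq_iff]
    · simp [T, he.eq_iff, h]
  have hout : ∀ p ∉ Set.range e, T (Pi.single p 1) = 0 := fun p hp => by
    ext i
    have : ∀ j, e (i, j) ≠ p := fun j h => hp ⟨_, h⟩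
    simp [T, this]
  -- Coordinates outside the layer are killed by `T`, so their characteristic functions are
  -- evaluated at zero and contribute the factor one.
  have key : ∏ q : κ × β, Complex.exp (-(v * s q.2 ^ 2 * (Λ (Pi.single q.1 1)) ^ 2 : ℝ) / 2) =
      ∏ p, charFunDual (lam p) ((Λ.comp T).comp (ContinuousLinearMap.single ℝ (fun _ => ℝ) p)) := by
    refine Fintype.prod_of_injective e he _ _ (fun p hp => ?_) (fun q => ?_)
    · rw [charFunDual_real_eq_charFun]
      simp [hout p hp]
    · rw [charFunDual_real_eq_charFun, hlam, charFun_gaussianReal]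
      have := hsingle q.1 q.2
      simp only [Prod.mk.eta] at this
      simp only [ContinuousLinearMap.comp_apply, ContinuousLinearMap.single_apply, this, map_smul,
        smul_eq_mul, Complex.ofReal_zero, mul_zero, zero_mul, zero_sub, Real.coe_toNNReal _ hv]
      congr 1
      push_cast
      ring
  rw [← key, Fintype.prod_prod_type]
  refine Finset.prod_congr rfl fun i _ => ?_
  rw [← Complex.exp_sum]
  congr 1
  have hq : 0 ≤ v * ∑ j, s j ^ 2 := mul_nonneg hv (Finset.sum_nonneg fun j _ => sq_nonneg _)
  have : Λ (R (Pi.single i 1)) = √(v * ∑ j, s j ^ 2) * Λ (Pi.single i 1) := by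
    simp [R]
  rw [ContinuousLinearMap.comp_apply, this, ← Complex.ofReal_pow, mul_pow, Real.sq_sqrt hq,
    Finset.mul_sum, Finset.sum_mul, ← Finset.sum_div, ← Complex.ofReal_neg, Finset.sum_neg_distrib]
  push_cast
  simp

/-- Averaging over a layer with Gaussian weights whose input does not depend on these weights. -/
lemma integral_gaussian_layer (lam : I → Measure ℝ)
    [∀ p, IsProbabilityMeasure (lam p)] {e : κ × β → I} (he : Function.Injective e) {v : ℝ}
    (hv : 0 ≤ v) (hlam : ∀ p, lam (e p) = gaussianReal 0 v.toNNReal)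
    {s : (I → ℝ) → β → ℝ} (hs : Measurable s)
    (hdep : ∀ w w' : I → ℝ, (∀ p ∉ Set.range e, w p = w' p) → s w = s w')
    {Φ : (κ → ℝ) → ℝ} {B : ℝ} (hΦ : Continuous Φ) (hb : ∀ y, |Φ y| ≤ B) :
    ∫ w, Φ (fun i => ∑ j, w (e (i, j)) * s w j) ∂(Measure.pi lam) =
      ∫ w, heat Φ (v * ∑ j, s w j ^ 2) ∂(Measure.pi lam) := by
  classical
  have hsj : ∀ j, Measurable fun w => s w j := fun j => (measurable_pi_apply j).comp hs
  have hm : Measurable fun (p : (I → ℝ) × (I → ℝ)) (i : I) =>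
      if i ∈ Set.range e then p.2 i else p.1 i := by
    refine measurable_pi_lambda _ fun i => ?_
    split_ifs <;> fun_prop
  have hΨ : Measurable fun w : I → ℝ => Φ (fun i => ∑ j, w (e (i, j)) * s w j) := by
    refine hΦ.measurable.comp (measurable_pi_lambda _ fun i => Finset.measurable_sum _ fun j _ => ?_)
    exact (measurable_pi_apply _).mul (hsj j)
  -- Redrawing the layer's weights from their own laws preserves the measure and separates them from
  -- its input `s`.
  have hmap := map_prod_pi_ite lam lam (Set.range e)
  simp only [ite_self] at hmap
  conv_lhs => rw [← hmap]
  rw [integral_map hm.aemeasurable hΨ.aestronglyMeasurable]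
  refine (integral_prod _ (.of_bound (hΨ.comp hm).aestronglyMeasurable B
    (Filter.Eventually.of_forall fun p => hb _))).trans ?_
  refine integral_congr_ae (Filter.Eventually.of_forall fun w => ?_)
  have h1 : ∀ t : I → ℝ, s (fun i => if i ∈ Set.range e then t i else w i) = s w := fun t =>
    hdep _ _ fun p hp => by simp [hp]
  have h2 : ∀ t : I → ℝ, Φ (fun i => ∑ j, (if e (i, j) ∈ Set.range e then t (e (i, j)) else
      w (e (i, j))) * s (fun i => if i ∈ Set.range e then t i else w i) j) =
      Φ (fun i => ∑ j, t (e (i, j)) * s w j) := fun t => by rw [h1]; simp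
  refine (integral_congr_ae (Filter.Eventually.of_forall h2)).trans ?_
  have hTm : Measurable fun (t : I → ℝ) (i : κ) => ∑ j, t (e (i, j)) * s w j := by fun_prop
  have hRm : Measurable fun z : κ → ℝ => √(v * ∑ j, s w j ^ 2) • z := by fun_prop
  have := integral_map (μ := Measure.pi lam) hTm.aemeasurable
    (f := Φ) hΦ.aestronglyMeasurable
  rw [map_mulVec_pi_gaussian lam he hv hlam (s w),
    integral_map hRm.aemeasurable hΦ.aestronglyMeasurable] at this
  simpa [heat] using this.symm

end GaussianLayer

/-! ### Taylor expansion and Lindeberg replacement -/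

section Lindeberg

lemma abs_le_pow_of_hasDerivAt {R r : ℝ → ℝ} {b : ℝ} {k : ℕ} (h0 : R 0 = 0)
    (h : ∀ t, HasDerivAt R (r t) t) (hr : ∀ t, |r t| ≤ b * |t| ^ k) (t : ℝ) :
    |R t| ≤ b * |t| ^ (k + 1) := by
  have hb : 0 ≤ b := by simpa using (abs_nonneg _).trans (hr 1)
  have := (convex_Icc (-|t|) |t|).norm_image_sub_le_of_norm_hasDerivWithin_le (f := R) (f' := r)
    (C := b * |t| ^ k) (x := 0) (y := t) (fun x _ => (h x).hasDerivWithinAt)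
    (fun x hx => (hr x).trans (by
      have := abs_le.2 ⟨hx.1, hx.2⟩
      gcongr)) (by simp) ⟨neg_abs_le t, le_abs_self t⟩
  simpa [h0, pow_succ, mul_assoc] using this

/-- Three uses of the mean value inequality starting from `φ₃`. The factor `1 / 6` is given up,
since only the order matters. -/
lemma abs_taylor_two_le {φ φ₁ φ₂ φ₃ : ℝ → ℝ} {b : ℝ} (h1 : ∀ t, HasDerivAt φ (φ₁ t) t)
    (h2 : ∀ t, HasDerivAt φ₁ (φ₂ t) t) (h3 : ∀ t, HasDerivAt φ₂ (φ₃ t) t)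
    (hb : ∀ t, |φ₃ t| ≤ b) (t : ℝ) :
    |φ t - (φ 0 + φ₁ 0 * t + φ₂ 0 / 2 * t ^ 2)| ≤ b * |t| ^ 3 := by
  have e2 := abs_le_pow_of_hasDerivAt (R := fun t => φ₂ t - φ₂ 0) (k := 0) (by simp)
    (fun t => (h3 t).sub_const _) (fun t => by simpa using hb t)
  have e1 := abs_le_pow_of_hasDerivAt (R := fun t => φ₁ t - φ₁ 0 - φ₂ 0 * t) (by simp)
    (fun t => by
      exact (((h2 t).sub_const (φ₁ 0)).sub ((hasDerivAt_id t).const_mul (φ₂ 0))).congr_deriv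
        (by simp)) e2
  refine abs_le_pow_of_hasDerivAt (R := fun t => φ t - (φ 0 + φ₁ 0 * t + φ₂ 0 / 2 * t ^ 2))
    (by simp) (fun t => ?_) e1 t
  have := (h1 t).sub ((((hasDerivAt_id t).const_mul (φ₁ 0)).const_add (φ 0)).add
    (((hasDerivAt_id t).pow 2).const_mul (φ₂ 0 / 2)))
  refine this.congr_deriv ?_
  simp
  ring

/-- Centred laws with variance `v` and third absolute moment at most `M`. -/
structure HasThirdMoment (μ : Measure ℝ) (v M : ℝ) : Prop where
  memLp : MemLp (fun t : ℝ => t) 3 μ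
  mean_zero : ∫ t, t ∂μ = 0
  second : ∫ t, t ^ 2 ∂μ = v
  third_le : ∫ t, |t| ^ 3 ∂μ ≤ M

/-- The linear Taylor term integrates to zero, so up to the cubic error the integral sees the law
only through `v`. Two laws with the same `v` can thus be compared. -/
lemma HasThirdMoment.abs_integral_sub_le {μ : Measure ℝ} [IsProbabilityMeasure μ] {v M : ℝ}
    (h : HasThirdMoment μ v M) {φ φ₁ φ₂ φ₃ : ℝ → ℝ} {b A : ℝ}
    (hA : ∀ t, |φ t| ≤ A)
    (h1 : ∀ t, HasDerivAt φ (φ₁ t) t) (h2 : ∀ t, HasDerivAt φ₁ (φ₂ t) t)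
    (h3 : ∀ t, HasDerivAt φ₂ (φ₃ t) t) (hb : ∀ t, |φ₃ t| ≤ b) :
    |∫ t, φ t ∂μ - (φ 0 + φ₂ 0 / 2 * v)| ≤ b * M := by
  have hb0 : 0 ≤ b := (abs_nonneg _).trans (hb 0)
  have hφ : Continuous φ := continuous_iff_continuousAt.2 fun t => (h1 t).continuousAt
  have i1 : Integrable (fun t : ℝ => t) μ :=
    h.memLp.integrable (by norm_num)
  have i2 : Integrable (fun t : ℝ => t ^ 2) μ :=
    (h.memLp.mono_exponent (p := 2) (by norm_num)).integrable_sq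
  have i3 : Integrable (fun t : ℝ => |t| ^ 3) μ := by
    simpa using h.memLp.integrable_norm_pow (p := 3) (by norm_num)
  have i0 : Integrable φ μ :=
    .of_bound hφ.aestronglyMeasurable A (Filter.Eventually.of_forall hA)
  have ia : Integrable (fun t => φ 0 + φ₁ 0 * t) μ := (integrable_const _).add (i1.const_mul _)
  have ip : Integrable (fun t => φ 0 + φ₁ 0 * t + φ₂ 0 / 2 * t ^ 2) μ := ia.add (i2.const_mul _)
  have e : ∫ t, (φ 0 + φ₁ 0 * t + φ₂ 0 / 2 * t ^ 2) ∂μ = φ 0 + φ₂ 0 / 2 * v := by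
    rw [integral_add ia (i2.const_mul _),
      integral_add (integrable_const _) (i1.const_mul _), integral_const_mul, integral_const_mul,
      h.mean_zero, h.second]
    simp
  rw [← e, ← integral_sub i0 ip]
  calc _ ≤ ∫ t, |φ t - (φ 0 + φ₁ 0 * t + φ₂ 0 / 2 * t ^ 2)| ∂μ := abs_integral_le_integral_abs
    _ ≤ ∫ t, b * |t| ^ 3 ∂μ :=
      integral_mono (i0.sub ip).abs (i3.const_mul b) (abs_taylor_two_le h1 h2 h3 hb)
    _ ≤ b * M := by
      rw [integral_const_mul]
      exact mul_le_mul_of_nonneg_left h.third_le hb0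

variable {I : Type*} [Fintype I] [DecidableEq I]

/-- Lindeberg's replacement of the coordinates in `S`. -/
lemma abs_integral_pi_sub_le (μ ν : I → Measure ℝ) [∀ p, IsProbabilityMeasure (μ p)]
    [∀ p, IsProbabilityMeasure (ν p)] {v M N : ℝ} (S : Finset I)
    (hμ : ∀ p ∈ S, HasThirdMoment (μ p) v M) (hν : ∀ p ∈ S, HasThirdMoment (ν p) v N)
    {f : (I → ℝ) → ℝ} {A b : ℝ} (hf : Measurable f) (hA : ∀ z, |f z| ≤ A)
    (hd : ∀ p ∈ S, ∀ z, ∃ φ₁ φ₂ φ₃ : ℝ → ℝ,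
      (∀ t, HasDerivAt (fun t => f (Function.update z p t)) (φ₁ t) t) ∧
      (∀ t, HasDerivAt φ₁ (φ₂ t) t) ∧ (∀ t, HasDerivAt φ₂ (φ₃ t) t) ∧ ∀ t, |φ₃ t| ≤ b) :
    |∫ z, f z ∂(Measure.pi (S.piecewise ν μ)) - ∫ z, f z ∂(Measure.pi μ)| ≤
      S.card * (b * (M + N)) := by
  induction S using Finset.induction_on with
  | empty => simp
  | insert p S hp ih =>
    have hprob : ∀ q, IsProbabilityMeasure (S.piecewise ν μ q) := fun q => by
      by_cases h : q ∈ S <;> simp [h] <;> infer_instance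
    have hi := ih (fun q hq => hμ q (Finset.mem_insert_of_mem hq))
      (fun q hq => hν q (Finset.mem_insert_of_mem hq))
      (fun q hq => hd q (Finset.mem_insert_of_mem hq))
    have hint : ∀ (m : I → Measure ℝ) [∀ q, IsProbabilityMeasure (m q)],
        Integrable f (Measure.pi m) := fun m _ =>
      .of_bound hf.aestronglyMeasurable A (Filter.Eventually.of_forall hA)
    -- Writing the old measure as an update at `p` too makes both integrals average over the same
    -- `z`, with coordinate `p` redrawn from `μ p` or `ν p`.
    have e1 : S.piecewise ν μ = Function.update (S.piecewise ν μ) p (μ p) := by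
      rw [eq_comm, Function.update_eq_self_iff]; simp [hp]
    have hstep : |∫ z, f z ∂(Measure.pi ((insert p S).piecewise ν μ)) -
        ∫ z, f z ∂(Measure.pi (S.piecewise ν μ))| ≤ b * (M + N) := by
      have hup : ∀ (m : Measure ℝ) [IsProbabilityMeasure m],
          ∀ q, IsProbabilityMeasure (Function.update (S.piecewise ν μ) p m q) := fun m _ q => by
        by_cases h : q = p
        · subst h; simpa
        · simpa [h] using hprob q
      have hj : ∀ (m : Measure ℝ) [IsProbabilityMeasure m],
          Integrable (fun z => ∫ t, f (Function.update z p t) ∂m)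
            (Measure.pi (S.piecewise ν μ)) := fun m _ =>
        Integrable.integral_prod_left (f := fun q : (I → ℝ) × ℝ => f (Function.update q.1 p q.2))
          (.of_bound (hf.comp (measurable_update_prod p)).aestronglyMeasurable A
            (Filter.Eventually.of_forall fun _ => hA _))
      have hupμ := hup (μ p)
      have hupν := hup (ν p)
      rw [Finset.piecewise_insert]
      conv_lhs => enter [1, 2]; rw [e1]
      rw [integral_pi_update _ p _ hf (hint _), integral_pi_update _ p _ hf (hint _),
        ← integral_sub (hj _) (hj _)]
      have hz : ∀ z, ‖∫ t, f (Function.update z p t) ∂(ν p) -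
          ∫ t, f (Function.update z p t) ∂(μ p)‖ ≤ b * (M + N) := fun z => by
        obtain ⟨φ₁, φ₂, φ₃, h1, h2, h3, hb⟩ := hd p (Finset.mem_insert_self p S) z
        have a1 := (hμ p (Finset.mem_insert_self p S)).abs_integral_sub_le (fun t => hA _)
          h1 h2 h3 hb
        have a2 := (hν p (Finset.mem_insert_self p S)).abs_integral_sub_le (fun t => hA _)
          h1 h2 h3 hb
        rw [Real.norm_eq_abs, abs_le]
        rw [abs_le] at a1 a2
        constructor <;> linarith [a1.1, a1.2, a2.1, a2.2]
      have := norm_integral_le_of_norm_le_const (μ := Measure.pi (S.piecewise ν μ))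
        (Filter.Eventually.of_forall hz)
      rwa [probReal_univ, mul_one] at this
    rw [Finset.card_insert_of_notMem hp]
    have := abs_sub_le (∫ z, f z ∂(Measure.pi ((insert p S).piecewise ν μ)))
      (∫ z, f z ∂(Measure.pi (S.piecewise ν μ))) (∫ z, f z ∂(Measure.pi μ))
    push_cast
    linarith

end Lindeberg

/-! ### The network as a function of finitely many weights, and the backward recursion -/

section Network

variable {σ : ℝ → ℝ} {n : ℕ → ℕ}

lemma dnn_congr {W W' : Weights n} (b : Biases n) (x : Fin (n 0) → ℝ) {ℓ : ℕ}
    (h : ∀ k ≤ ℓ, W k = W' k) : dnn σ n W b x ℓ = dnn σ n W' b x ℓ := by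
  induction ℓ with
  | zero => simp [dnn, h 0 le_rfl]
  | succ ℓ ih => simp [dnn, h (ℓ + 1) le_rfl, ih fun k hk => h k (by lia)]

/-- The weight matrices with prescribed entries in the layers `1, …, L + 1`. -/
def weightsOf {L : ℕ} (w : WeightIndex L n → ℝ) : Weights n :=
  fun ℓ i j => if h : ℓ < L + 1 then w ⟨⟨ℓ, h⟩, (i, j)⟩ else 0

/-- The positions of the weights of layer `ℓ + 1`. -/
def layerIndex {L : ℕ} (n : ℕ → ℕ) {ℓ : ℕ} (h : ℓ < L + 1) (q : Fin (n (ℓ + 1)) × Fin (n ℓ)) :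
    WeightIndex L n := ⟨⟨ℓ, h⟩, q⟩

variable {L : ℕ}

lemma layerIndex_injective {ℓ : ℕ} (h : ℓ < L + 1) : Function.Injective (layerIndex n h) :=
  fun q q' hq => by simpa [layerIndex] using hq

lemma mem_range_layerIndex {ℓ : ℕ} (h : ℓ < L + 1) {p : WeightIndex L n} :
    p ∈ Set.range (layerIndex n h) ↔ (p.1 : ℕ) = ℓ := by
  constructor
  · rintro ⟨q, rfl⟩; rfl
  · rintro rfl; exact ⟨p.2, rfl⟩

lemma dnn_weightsOf_succ (w : WeightIndex L n → ℝ) (x : Fin (n 0) → ℝ) {ℓ : ℕ}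
    (h : ℓ + 1 < L + 1) (i : Fin (n (ℓ + 1 + 1))) :
    dnn σ n (weightsOf w) 0 x (ℓ + 1) i =
      ∑ j, w (layerIndex n h (i, j)) * σ (dnn σ n (weightsOf w) 0 x ℓ j) := by
  simp [dnn, Matrix.mulVec, dotProduct, weightsOf, layerIndex, Nat.lt_of_succ_lt_succ h]

lemma dnn_weightsOf_congr {w w' : WeightIndex L n → ℝ} (x : Fin (n 0) → ℝ) {ℓ : ℕ}
    (h : ∀ p : WeightIndex L n, (p.1 : ℕ) ≤ ℓ → w p = w' p) :
    dnn σ n (weightsOf w) 0 x ℓ = dnn σ n (weightsOf w') 0 x ℓ := by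
  refine dnn_congr _ _ fun k hk => ?_
  ext i j
  by_cases hkL : k < L + 1
  · simp only [weightsOf, hkL, dif_pos]; exact h _ hk
  · simp [weightsOf, hkL]

lemma measurable_dnn_weightsOf (hσ : Measurable σ) (x : Fin (n 0) → ℝ) (ℓ : ℕ) :
    Measurable fun w : WeightIndex L n → ℝ => dnn σ n (weightsOf w) 0 x ℓ := by
  have hW : ∀ k i j, Measurable fun w : WeightIndex L n → ℝ => weightsOf w k i j := fun k i j => by
    by_cases hk : k < L + 1
    · simp only [weightsOf, hk, dif_pos]; exact measurable_pi_apply _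
    · simp only [weightsOf, hk, dif_neg, not_false_eq_true]; exact measurable_const
  induction ℓ with
  | zero =>
    refine measurable_pi_lambda _ fun i => ?_
    simp only [dnn, Matrix.mulVec, dotProduct, Pi.add_apply, Pi.zero_apply, add_zero]
    exact Finset.measurable_sum _ fun j _ => (hW _ _ _).mul_const _
  | succ ℓ ih =>
    refine measurable_pi_lambda _ fun i => ?_
    simp only [dnn, Matrix.mulVec, dotProduct, Pi.add_apply, Pi.zero_apply, add_zero]
    exact Finset.measurable_sum _ fun j _ =>
      (hW _ _ _).mul (hσ.comp ((measurable_pi_apply j).comp ih))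

/-- The value, as a function of the preactivation `y` of a layer, of the Gaussian average of `Φ`
over the weights of the next layer. -/
noncomputable def gaussianBackward {ι κ : Type*} [Fintype ι] [Fintype κ] (σ : ℝ → ℝ) (CW : ℝ)
    (Φ : (κ → ℝ) → ℝ) (y : ι → ℝ) : ℝ :=
  heat Φ ((Fintype.card ι : ℝ)⁻¹ * ∑ i, CW * (σ (y i) * σ (y i)))

/-- A width-free smooth function `heat Φ` is composed with a width-free average of squares. The
constant `K` precedes both index types, so the recursion stays uniform in the widths. -/
lemma exists_bddPartials_gaussianBackward {m : ℕ} {A CW : ℝ} (hCW : 0 ≤ CW)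
    (hσ : BddDerivs Set.univ m A σ) (B : ℝ) : ∃ K : ℝ,
    ∀ (ι κ : Type) [Fintype ι] [DecidableEq ι] [Nonempty ι] [Fintype κ] [DecidableEq κ]
      [Nonempty κ] (Φ : (κ → ℝ) → ℝ), BddPartials (2 * m) ∅ B Φ →
      BddPartials m (∅ : Finset ι) K (gaussianBackward σ CW Φ) := by
  obtain ⟨K, hK⟩ := BddPartials.exists_bddDerivs_heat m B
  refine ⟨compBound K ((m + 1) * (|CW| * (2 ^ m * (A * A)))) m, fun ι κ _ _ _ _ _ _ Φ hΦ => ?_⟩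
  refine BddPartials.comp (s := Set.Ici 0) (fun y => ?_) (hK κ Φ hΦ)
    (BddPartials.sq_average hσ CW)
  exact mul_nonneg (by positivity) (Finset.sum_nonneg fun i _ =>
    mul_nonneg hCW (mul_self_nonneg _))

lemma integral_dnn_gaussianBackward {CW : ℝ} (hCW : 0 ≤ CW) (hσ : Measurable σ)
    (lam : WeightIndex L n → Measure ℝ) [∀ p, IsProbabilityMeasure (lam p)] (x : Fin (n 0) → ℝ)
    {ℓ : ℕ} (h : ℓ + 1 < L + 1)
    (hlam : ∀ p : WeightIndex L n, (p.1 : ℕ) = ℓ + 1 →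
      lam p = gaussianReal 0 (CW / (n (ℓ + 1) : ℝ)).toNNReal)
    {Φ : (Fin (n (ℓ + 1 + 1)) → ℝ) → ℝ} {B : ℝ} (hΦ : Continuous Φ) (hb : ∀ y, |Φ y| ≤ B) :
    ∫ w, Φ (dnn σ n (weightsOf w) 0 x (ℓ + 1)) ∂(Measure.pi lam) =
      ∫ w, gaussianBackward σ CW Φ (dnn σ n (weightsOf w) 0 x ℓ) ∂(Measure.pi lam) := by
  have key := integral_gaussian_layer lam (layerIndex_injective h)
    (v := CW / (n (ℓ + 1) : ℝ)) (by positivity) (fun p => hlam _ rfl)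
    (s := fun w j => σ (dnn σ n (weightsOf w) 0 x ℓ j))
    (measurable_pi_lambda _ fun j =>
      hσ.comp ((measurable_pi_apply j).comp (measurable_dnn_weightsOf hσ x ℓ)))
    (fun w w' hw => by
      have : dnn σ n (weightsOf w) 0 x ℓ = dnn σ n (weightsOf w') 0 x ℓ :=
        dnn_weightsOf_congr x fun p hp => hw p (by rw [mem_range_layerIndex]; lia)
      simp only [this]) hΦ hb
  convert key using 3 with w w
  · exact congrArg Φ (funext fun i => dnn_weightsOf_succ w x h i)
  · rw [gaussianBackward, ← Finset.mul_sum, Fintype.card_fin]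
    congr 1
    simp only [sq]
    ring

/-- Averaging over all Gaussian layers after the layer `k + 1`. -/
lemma exists_backward {L d : ℕ} (hσ : IsCb (3 * 2 ^ (L - 1)) σ) {F : (Fin d → ℝ) → ℝ}
    (hF : IsCb (3 * 2 ^ (L - 1)) F) {CW : ℝ} (hCW : 0 ≤ CW) {k : ℕ} (hkL : k ≤ L) :
    1 ≤ k → ∃ B : ℝ, ∀ (n : ℕ → ℕ) (_ : ∀ ℓ ≤ L + 1, 0 < n ℓ) (hd : n (L + 1) = d),
      ∃ Φ : (Fin (n (k + 1)) → ℝ) → ℝ, BddPartials (3 * 2 ^ (k - 1)) ∅ B Φ ∧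
        ∀ (lam : WeightIndex L n → Measure ℝ) [∀ p, IsProbabilityMeasure (lam p)]
          (_ : ∀ p : WeightIndex L n, k < (p.1 : ℕ) →
            lam p = gaussianReal 0 (CW / (n p.1 : ℝ)).toNNReal) (x : Fin (n 0) → ℝ),
          ∫ w, F (fun i => dnn σ n (weightsOf w) 0 x L (Fin.cast hd.symm i)) ∂(Measure.pi lam) =
            ∫ w, Φ (dnn σ n (weightsOf w) 0 x k) ∂(Measure.pi lam) := by
  induction hkL using Nat.decreasingInduction with
  | self =>
    intro _
    obtain ⟨B, hB⟩ := hF.exists_bddPartials ∅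
    refine ⟨B, fun n hn hd => ⟨fun y => F fun i => y (Fin.cast hd.symm i), ?_,
      fun lam _ _ x => rfl⟩⟩
    subst hd
    exact hB
  | of_succ k hk ih =>
    intro hk1
    obtain ⟨B, hB⟩ := ih (by lia)
    -- The orders double from `k` to `k + 1` only because `1 ≤ k`; at `k = 0` the truncated
    -- subtraction would break this.
    have hpow : 2 * (3 * 2 ^ (k - 1)) = 3 * 2 ^ (k + 1 - 1) := by
      obtain ⟨k, rfl⟩ : ∃ k', k = k' + 1 := ⟨k - 1, by lia⟩
      simp [pow_succ]; ring
    obtain ⟨A, hA⟩ := hσ.exists_bddDerivs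
    have hle : 3 * 2 ^ (k - 1) ≤ 3 * 2 ^ (L - 1) :=
      Nat.mul_le_mul_left 3 (Nat.pow_le_pow_right (by norm_num) (by lia))
    obtain ⟨K, hK⟩ := exists_bddPartials_gaussianBackward hCW (hA.of_le hle) B
    refine ⟨K, fun n hn hd => ?_⟩
    obtain ⟨Φ, hΦ, hint⟩ := hB n hn hd
    have := Fin.pos_iff_nonempty.1 (hn (k + 1) (by lia))
    have := Fin.pos_iff_nonempty.1 (hn (k + 1 + 1) (by lia))
    rw [← hpow] at hΦ
    refine ⟨gaussianBackward σ CW Φ, hK _ _ Φ hΦ, fun lam _ hlam x => ?_⟩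
    rw [hint lam (fun p hp => hlam p (by lia)) x]
    exact integral_dnn_gaussianBackward hCW hσ.1.continuous.measurable lam x (by lia)
      (fun p hp => by rw [hlam p (by lia), hp]) hΦ.continuous hΦ.abs_le

end Network

/-! ### Moments of the rescaled weight laws -/

section ThirdMoment

lemma IsWeightLaw.hasThirdMoment_map {μ : Measure ℝ} [IsProbabilityMeasure μ]
    (hμ : IsWeightLaw μ) {a : ℝ} (ha : 0 ≤ a) :
    HasThirdMoment (μ.map (fun t => a * t)) (a ^ 2) (a ^ 3 * ∫ t, |t| ^ 3 ∂μ) := by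
  have hm : Measurable fun t : ℝ => a * t := by fun_prop
  have hs : ∫ t, t ^ 2 ∂μ = 1 := by
    have := hμ.variance_one
    rwa [variance_of_integral_eq_zero (X := fun t : ℝ => t) (by fun_prop) hμ.mean_zero] at this
  refine ⟨?_, ?_, ?_, le_of_eq ?_⟩
  · rw [memLp_map_measure_iff (by fun_prop) hm.aemeasurable]
    exact hμ.third_moment.const_mul a
  · rw [integral_map hm.aemeasurable (by fun_prop), integral_const_mul, hμ.mean_zero, mul_zero]
  · rw [integral_map hm.aemeasurable (by fun_prop)]
    simp_rw [mul_pow]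
    rw [integral_const_mul, hs, mul_one]
  · rw [integral_map hm.aemeasurable (by fun_prop)]
    simp_rw [abs_mul, mul_pow, abs_of_nonneg ha]
    rw [integral_const_mul]

lemma isWeightLaw_gaussianReal : IsWeightLaw (gaussianReal 0 1) :=
  ⟨memLp_id_gaussianReal 3, integral_id_gaussianReal, by simp [variance_fun_id_gaussianReal]⟩

lemma gaussianReal_eq_map_const_mul {v : ℝ} (hv : 0 ≤ v) :
    gaussianReal 0 v.toNNReal = (gaussianReal 0 1).map (fun t => √v * t) := by
  rw [gaussianReal_map_const_mul]
  congr 1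
  · simp
  · ext
    simp [Real.sq_sqrt hv, hv]

end ThirdMoment

/-- The third derivative along a coordinate direction of a function in `BddPartials 3 ∅ B`. -/
lemma BddPartials.exists_line_derivs {ι : Type*} [Fintype ι] [DecidableEq ι] [Nonempty ι]
    {Φ : (ι → ℝ) → ℝ} {B : ℝ} (h : BddPartials 3 ∅ B Φ) (i : ι) (y : ι → ℝ) {s A : ℝ}
    (hs : |s| ≤ A) : ∃ φ₁ φ₂ φ₃ : ℝ → ℝ,
      (∀ t, HasDerivAt (fun t => Φ (y + t • Pi.single i s)) (φ₁ t) t) ∧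
      (∀ t, HasDerivAt φ₁ (φ₂ t) t) ∧ (∀ t, HasDerivAt φ₂ (φ₃ t) t) ∧
      ∀ t, |φ₃ t| ≤ (Fintype.card ι : ℝ)⁻¹ * (A ^ 3 * B) := by
  have hB := h.nonneg
  have hA : 0 ≤ A := (abs_nonneg s).trans hs
  have hn : (0 : ℝ) < Fintype.card ι := by exact_mod_cast Fintype.card_pos
  obtain ⟨_, f', h1, k1⟩ := h
  obtain ⟨_, g', h2, k2⟩ := k1 i
  obtain ⟨_, l', h3, k3⟩ := k2 i
  have hb := (k3 i).2
  -- Only the first derivative along `i` carries the weight `n`; the next two find `i` already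
  -- exempt. Hence a single factor `1 / n` in the final bound.
  simp only [Finset.notMem_empty, if_false, Finset.mem_insert_self, if_true, one_mul] at h2 h3 hb
  have hl : ∀ t, HasDerivAt (fun t : ℝ => y + t • Pi.single i s) (Pi.single i s) t := fun t => by
    exact (((hasDerivAt_id t).smul_const (Pi.single i s : ι → ℝ)).const_add y).congr_deriv
      (one_smul ℝ _)
  refine ⟨fun t => s * (Fintype.card ι : ℝ)⁻¹ * (Fintype.card ι * f' i (y + t • Pi.single i s)),
    fun t => s ^ 2 * (Fintype.card ι : ℝ)⁻¹ * g' i (y + t • Pi.single i s),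
    fun t => s ^ 3 * (Fintype.card ι : ℝ)⁻¹ * l' i (y + t • Pi.single i s), fun t => ?_,
    fun t => ?_, fun t => ?_, fun t => ?_⟩
  · refine ((h1 _).comp_hasDerivAt t (hl t)).congr_deriv ?_
    simp [Pi.single_apply]
    field_simp
  · refine (((h2 _).comp_hasDerivAt t (hl t)).const_mul _).congr_deriv ?_
    simp [Pi.single_apply]
    ring
  · refine (((h3 _).comp_hasDerivAt t (hl t)).const_mul _).congr_deriv ?_
    simp [Pi.single_apply]
    ring
  · rw [abs_mul, abs_mul, abs_pow, abs_of_pos (inv_pos.2 hn), mul_comm (|s| ^ 3), mul_assoc]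
    have := hb (y + t • Pi.single i s)
    gcongr

/-! ### Replacing one layer -/

section Replacement

variable {σ : ℝ → ℝ} {n : ℕ → ℕ} {L : ℕ}

/-- Replacing the weights of the layer `k + 2` by Gaussian ones. -/
lemma abs_integral_layer_sub_le {CW A B : ℝ} (hCW : 0 ≤ CW) {μ : Measure ℝ}
    [IsProbabilityMeasure μ] (hμ : IsWeightLaw μ) (hσ : Measurable σ) (hA : ∀ t, |σ t| ≤ A)
    {k : ℕ} (hk : k + 1 < L + 1) (hn : 0 < n (k + 1)) (hn' : 0 < n (k + 1 + 1))
    {Φ : (Fin (n (k + 1 + 1)) → ℝ) → ℝ} (hΦ : BddPartials 3 ∅ B Φ)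
    (lam lam' : WeightIndex L n → Measure ℝ) [∀ p, IsProbabilityMeasure (lam p)]
    [∀ p, IsProbabilityMeasure (lam' p)]
    (hlam : ∀ p : WeightIndex L n, (p.1 : ℕ) = k + 1 →
      lam p = gaussianReal 0 (CW / (n (k + 1) : ℝ)).toNNReal)
    (hlam' : ∀ p : WeightIndex L n, (p.1 : ℕ) = k + 1 →
      lam' p = μ.map (fun t => √(CW / (n (k + 1) : ℝ)) * t))
    (heq : ∀ p : WeightIndex L n, (p.1 : ℕ) ≠ k + 1 → lam' p = lam p) (x : Fin (n 0) → ℝ) :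
    |∫ w, Φ (dnn σ n (weightsOf w) 0 x (k + 1)) ∂(Measure.pi lam') -
      ∫ w, Φ (dnn σ n (weightsOf w) 0 x (k + 1)) ∂(Measure.pi lam)| ≤
      A ^ 3 * B * √CW ^ 3 * (∫ t, |t| ^ 3 ∂(gaussianReal 0 1) + ∫ t, |t| ^ 3 ∂μ) /
        √(n (k + 1) : ℝ) := by
  classical
  have := Fin.pos_iff_nonempty.1 hn'
  set a := √(CW / (n (k + 1) : ℝ)) with ha
  have ha0 : 0 ≤ a := Real.sqrt_nonneg _
  let S : Finset (WeightIndex L n) := Finset.univ.map ⟨layerIndex n hk, layerIndex_injective hk⟩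
  have hS : ∀ p, p ∈ S ↔ (p.1 : ℕ) = k + 1 := fun p => by
    rw [← mem_range_layerIndex hk]; simp [S]
  have hpw : S.piecewise lam' lam = lam' := by
    ext1 p
    by_cases hp : p ∈ S
    · simp [hp]
    · simp only [hp, not_false_eq_true, Finset.piecewise_eq_of_notMem]
      exact (heq p fun h => hp ((hS p).2 h)).symm
  have key := abs_integral_pi_sub_le lam lam' (v := a ^ 2) S
    (fun p hp => by
      rw [hlam p ((hS p).1 hp), gaussianReal_eq_map_const_mul (by positivity)]
      exact isWeightLaw_gaussianReal.hasThirdMoment_map ha0)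
    (fun p hp => by
      rw [hlam' p ((hS p).1 hp)]
      exact hμ.hasThirdMoment_map ha0)
    (f := fun w => Φ (dnn σ n (weightsOf w) 0 x (k + 1)))
    (hΦ.continuous.measurable.comp (measurable_dnn_weightsOf hσ x (k + 1)))
    (fun w => hΦ.abs_le _)
    (b := (Fintype.card (Fin (n (k + 1 + 1))) : ℝ)⁻¹ * (A ^ 3 * B))
    (fun p hp w => by
      obtain ⟨⟨i, j⟩, rfl⟩ := (mem_range_layerIndex hk).2 ((hS p).1 hp)
      have hdep : ∀ t, dnn σ n (weightsOf (Function.update w (layerIndex n hk (i, j)) t)) 0 x k =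
          dnn σ n (weightsOf w) 0 x k := fun t => dnn_weightsOf_congr x fun p hp =>
        Function.update_of_ne (fun h => by subst h; simp [layerIndex] at hp) _ _
      -- The layer output is affine in the single entry `(i, j)`: only coordinate `i` moves, with
      -- slope `σ` of the `j`-th preactivation, which is bounded by `A`.
      have hline : ∀ t, dnn σ n
          (weightsOf (Function.update w (layerIndex n hk (i, j)) t)) 0 x (k + 1) =
          dnn σ n (weightsOf (Function.update w (layerIndex n hk (i, j)) 0)) 0 x (k + 1) +
            t • Pi.single i (σ (dnn σ n (weightsOf w) 0 x k j)) := fun t => by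
        ext i'
        rw [Pi.add_apply, dnn_weightsOf_succ _ x hk, dnn_weightsOf_succ _ x hk, hdep, hdep,
          ← sub_eq_iff_eq_add', ← Finset.sum_sub_distrib, Finset.sum_eq_single j]
        · by_cases hi : i' = i
          · subst hi; simp
          · have : layerIndex n hk (i', j) ≠ layerIndex n hk (i, j) := fun h =>
              hi (Prod.ext_iff.1 (layerIndex_injective hk h)).1
            simp [this, hi]
        · intro j' _ hj'
          have : layerIndex n hk (i', j') ≠ layerIndex n hk (i, j) := fun h =>
            hj' (Prod.ext_iff.1 (layerIndex_injective hk h)).2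
          simp [this]
        · simp
      have hex := hΦ.exists_line_derivs i
        (dnn σ n (weightsOf (Function.update w (layerIndex n hk (i, j)) 0)) 0 x (k + 1))
        (hA (dnn σ n (weightsOf w) 0 x k j))
      rw [← funext fun t => congrArg Φ (hline t)] at hex
      exact hex)
  rw [hpw] at key
  refine key.trans_eq ?_
  have hcard : S.card = n (k + 1 + 1) * n (k + 1) := by simp [S]
  have h1 : (0 : ℝ) < n (k + 1) := by exact_mod_cast hn
  have h2 : (0 : ℝ) < n (k + 1 + 1) := by exact_mod_cast hn'
  have h3 : (n (k + 1) : ℝ) = √(n (k + 1) : ℝ) ^ 2 := (Real.sq_sqrt h1.le).symm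
  have h4 : 0 < √(n (k + 1) : ℝ) := Real.sqrt_pos.2 h1
  -- The count `n (k + 2) * n (k + 1)` meets `1 / n (k + 2)` from the third derivative and `n (k +
  -- 1) ^ (-3/2)` from `a ^ 3`.
  rw [hcard, ha, Real.sqrt_div hCW, Fintype.card_fin, Nat.cast_mul]
  generalize √(n (k + 1) : ℝ) = r at h3 h4 ⊢
  rw [h3]
  field_simp

end Replacement

/-! ### From random weights to product measures -/

section Law

variable {Ω : Type*} [MeasurableSpace Ω] {P : Measure Ω} [IsProbabilityMeasure P] {L : ℕ}
  {n : ℕ → ℕ} {CW : ℝ} {μ : Measure ℝ} {W G : Ω → Weights n}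

/-- The law of the weight at position `p` of the network in which the layers after `m` are
Gaussian. -/
noncomputable def switchedLaw (P : Measure Ω) (CW : ℝ) (W : Ω → Weights n) (m : ℕ)
    (p : WeightIndex L n) : Measure ℝ :=
  if (p.1 : ℕ) + 1 ≤ m then P.map (fun ω => W ω p.1 p.2.1 p.2.2)
    else gaussianReal 0 (CW / (n p.1 : ℝ)).toNNReal

omit [IsProbabilityMeasure P] in
lemma IsRandomInit.aemeasurable_weight (h : IsRandomInit P L n CW μ W G) (p : WeightIndex L n) :
    AEMeasurable (fun ω => W ω p.1 p.2.1 p.2.2) P := by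
  obtain ⟨⟨ℓ, hℓ⟩, i, j⟩ := p
  cases ℓ with
  | zero => exact (h.first_third_moment i j).aestronglyMeasurable.aemeasurable
  | succ ℓ => exact (h.law_W (ℓ + 1) (by lia) (by lia) i j).aemeasurable

lemma IsRandomInit.isProbabilityMeasure_switchedLaw (h : IsRandomInit P L n CW μ W G) (m : ℕ)
    (p : WeightIndex L n) : IsProbabilityMeasure (switchedLaw P CW W m p) := by
  unfold switchedLaw
  split_ifs
  · exact Measure.isProbabilityMeasure_map (h.aemeasurable_weight p)
  · infer_instance

/-- The network uses at each position either the `W` or the `G` entry. This injective selection from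
an independent family is independent, so its joint law is a product. -/
lemma IsRandomInit.integral_switchedOutput (h : IsRandomInit P L n CW μ W G) {σ : ℝ → ℝ}
    (hσ : Measurable σ) {F : (Fin (n (L + 1)) → ℝ) → ℝ} (hF : Measurable F) (m : ℕ)
    (x : Fin (n 0) → ℝ) :
    ∫ ω, F (switchedOutput σ L n m (W ω) (G ω) x) ∂P =
      ∫ w, F (dnn σ n (weightsOf w) 0 x L) ∂(Measure.pi (switchedLaw (L := L) P CW W m)) := by
  let X : WeightIndex L n → Ω → ℝ := fun p ω =>
    switchedWeights n m (W ω) (G ω) p.1 p.2.1 p.2.2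
  let g : WeightIndex L n → WeightIndex L n ⊕ WeightIndex L n := fun p =>
    if (p.1 : ℕ) + 1 ≤ m then Sum.inl p else Sum.inr p
  have hg : Function.Injective g := fun p q hpq => by
    simp only [g] at hpq
    split_ifs at hpq <;> simpa using hpq
  have hX : ∀ p, X p = fun ω => Sum.elim (fun q : WeightIndex L n => W ω q.1 q.2.1 q.2.2)
      (fun q : WeightIndex L n => G ω q.1 q.2.1 q.2.2) (g p) := fun p => by
    ext ω
    by_cases hp : (p.1 : ℕ) + 1 ≤ m
    · simp only [X, g, switchedWeights, if_pos hp, Sum.elim_inl]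
    · simp only [X, g, switchedWeights, if_neg hp, Sum.elim_inr]
  have hind : iIndepFun X P := by
    rw [show X = _ from funext hX]
    exact h.indep.precomp hg
  have hlaw : ∀ p, AEMeasurable (X p) P ∧ P.map (X p) = switchedLaw P CW W m p := fun p => by
    by_cases hp : (p.1 : ℕ) + 1 ≤ m
    · have e : X p = fun ω => W ω p.1 p.2.1 p.2.2 := by
        ext ω; simp only [X, switchedWeights, if_pos hp]
      rw [e]
      exact ⟨h.aemeasurable_weight p, by simp only [switchedLaw, if_pos hp]⟩
    · have e : X p = fun ω => G ω p.1 p.2.1 p.2.2 := by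
        ext ω; simp only [X, switchedWeights, if_neg hp]
      have := h.law_G p.1 (by have := p.1.2; lia) p.2.1 p.2.2
      rw [e]
      exact ⟨this.aemeasurable, by simp only [switchedLaw, if_neg hp, this.map_eq]⟩
  have hmap := (iIndepFun_iff_map_fun_eq_pi_map fun p => (hlaw p).1).1 hind
  simp only [fun p => (hlaw p).2] at hmap
  rw [← hmap]
  refine Eq.trans ?_ (integral_map (aemeasurable_pi_lambda _ fun p => (hlaw p).1)
    (hF.comp (measurable_dnn_weightsOf hσ x L)).aestronglyMeasurable).symm
  refine integral_congr_ae (Filter.Eventually.of_forall fun ω => ?_)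
  simp only [switchedOutput]
  refine congrArg F (dnn_congr 0 x fun k hk => ?_)
  ext i j
  simp [weightsOf, Nat.lt_succ_of_le hk]

end Law

/-! ### Assembly of the bound -/

theorem mainTheorem5 (L : ℕ) (hL : 1 ≤ L) (d : ℕ)
    (σ : ℝ → ℝ) (hσ : IsCb (3 * 2 ^ (L - 1)) σ)
    (F : (Fin d → ℝ) → ℝ) (hF : IsCb (3 * 2 ^ (L - 1)) F)
    (CW : ℝ) (hCW : 0 < CW)
    (μ : Measure ℝ) [IsProbabilityMeasure μ] (hμ : IsWeightLaw μ) :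
    -- the constant does not depend on the widths `n 0, …, n L`, on the input, or on `k = L - K - 1`
    ∃ C : ℝ, ∀ (n : ℕ → ℕ) (_ : ∀ ℓ ≤ L + 1, 0 < n ℓ) (hd : n (L + 1) = d)
      (Ω : Type*) [MeasurableSpace Ω] (P : Measure Ω) [IsProbabilityMeasure P]
      (W G : Ω → Weights n) (_ : IsRandomInit P L n CW μ W G)
      (x : Fin (n 0) → ℝ) (k : ℕ) (_ : 1 ≤ k) (_ : k ≤ L),
      |(∫ ω, F (fun i => switchedOutput σ L n (k + 1) (W ω) (G ω) x (Fin.cast hd.symm i)) ∂P)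
        - ∫ ω, F (fun i => switchedOutput σ L n k (W ω) (G ω) x (Fin.cast hd.symm i)) ∂P|
        ≤ C / √(n k : ℝ) := by

  obtain ⟨A, hA⟩ := hσ.exists_bddDerivs
  have hA' : ∀ t, |σ t| ≤ A := fun t => hA.abs_le t trivial
  have hσm : Measurable σ := hσ.1.continuous.measurable
  have hback : ∀ k, ∃ B : ℝ, 1 ≤ k → k ≤ L → ∀ (n : ℕ → ℕ) (_ : ∀ ℓ ≤ L + 1, 0 < n ℓ)
      (hd : n (L + 1) = d), ∃ Φ : (Fin (n (k + 1)) → ℝ) → ℝ, BddPartials (3 * 2 ^ (k - 1)) ∅ B Φ ∧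
        ∀ (lam : WeightIndex L n → Measure ℝ) [∀ p, IsProbabilityMeasure (lam p)]
          (_ : ∀ p : WeightIndex L n, k < (p.1 : ℕ) →
            lam p = gaussianReal 0 (CW / (n p.1 : ℝ)).toNNReal) (x : Fin (n 0) → ℝ),
          ∫ w, F (fun i => dnn σ n (weightsOf w) 0 x L (Fin.cast hd.symm i)) ∂(Measure.pi lam) =
            ∫ w, Φ (dnn σ n (weightsOf w) 0 x k) ∂(Measure.pi lam) := fun k => by
    by_cases hk : 1 ≤ k ∧ k ≤ L
    · obtain ⟨B, hB⟩ := exists_backward hσ hF hCW.le hk.2 hk.1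
      exact ⟨B, fun _ _ => hB⟩
    · exact ⟨0, fun h1 h2 => absurd ⟨h1, h2⟩ hk⟩
  choose B hB using hback
  set T := ∫ t, |t| ^ 3 ∂(gaussianReal 0 1) + ∫ t, |t| ^ 3 ∂μ with hT
  -- The constant from the backward recursion depends on the swapped layer; summing absolute values
  -- gives one constant for all `k ≤ L`.
  refine ⟨∑ k ∈ Finset.range (L + 1), |A ^ 3 * B k * √CW ^ 3 * T|,
    fun n hn hd Ω _ P _ W G h x k hk hkL => ?_⟩
  obtain ⟨Φ, hΦ, hint⟩ := hB k hk hkL n hn hd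
  have hFm : Measurable fun y : Fin (n (L + 1)) → ℝ => F fun i => y (Fin.cast hd.symm i) :=
    hF.1.continuous.measurable.comp (by fun_prop)
  have e := fun m => h.integral_switchedOutput hσm hFm m x
  have hprob := fun m => h.isProbabilityMeasure_switchedLaw m
  have := hprob k
  have := hprob (k + 1)
  -- Layers of index above `k` are Gaussian in both networks, so the same `Φ` represents both
  -- expectations.
  rw [e, e, hint _ (fun p hp => by simp [switchedLaw]; lia),
    hint _ (fun p hp => by simp [switchedLaw]; lia)]
  obtain ⟨k, rfl⟩ : ∃ k', k = k' + 1 := ⟨k - 1, by lia⟩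
  have hΦ3 : BddPartials 3 ∅ (B (k + 1)) Φ := hΦ.of_le (Nat.le_mul_of_pos_right 3 (by positivity))
  refine (abs_integral_layer_sub_le hCW.le hμ hσm hA' (by lia) (hn _ (by lia)) (hn _ (by lia)) hΦ3
    _ _ (fun p hp => by simp [switchedLaw, hp])
    (fun p hp => ?_) (fun p hp => ?_) x).trans ?_
  · obtain ⟨⟨ℓ, hℓ⟩, i, j⟩ := p
    obtain rfl : ℓ = k + 1 := hp
    simp [switchedLaw, (h.law_W (k + 1) (by lia) hkL i j).map_eq]
  · have : (p.1 : ℕ) + 1 ≤ k + 1 + 1 ↔ (p.1 : ℕ) + 1 ≤ k + 1 := by lia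
    simp only [switchedLaw, this]
  · refine div_le_div_of_nonneg_right ((le_abs_self _).trans ?_) (Real.sqrt_nonneg _)
    exact Finset.single_le_sum (f := fun k => |A ^ 3 * B k * √CW ^ 3 * T|)
      (fun k _ => abs_nonneg _) (Finset.mem_range.2 (by lia))
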